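/- Let $D\in\mathbb N$, $\epsilon>0$, let $\Gamma\in\mathbb R^{D\times D}$ be symmetric positive definite, and let $V:\mathbb R^D\to\mathbb R$ be a smooth sub-quadratic potential, i.e. all derivatives of $V$ of order at least $2$ are bounded. For $z=(q,p)\in\mathbb R^{2D}$ put $$g_z(x)=\Big(\frac{\det\Gamma}{\pi^D\epsilon^D}\Big)^{1/4}\exp\Big(-\frac1{2\epsilon}(x-q)^T\Gamma(x-q)+\frac i\epsilon p^T(x-q)\Big),\qquad \langle\varphi,\psi\rangle=\int_{\mathbb R^D}\overline{\varphi(x)}\,\psi(x)\,dx .$$ Let $z(t)=(q(t),p(t))$ be the solution of $\dot q=p$, $\dot p=-\nabla V(q)$, $z(0)=z$; let $S_t(z)=\int_0^t\big(\tfrac12|p(s)|^2-V(q(s))\big)\,ds$; and let $M(t)=\begin{pmatrix}M_{qq}&M_{qp}\\M_{pq}&M_{pp}\end{pmatrix}$ be the stability matrix $\partial z(t)/\partial z$, that is, the solution of $$\dot M(t)=\begin{pmatrix}0&\mathrm{Id}\\-\mathrm{Id}&0\end{pmatrix}\begin{pmatrix}\mathrm{Hess}\,V(q(t))&0\\0&\mathrm{Id}\end{pmatrix}M(t),\qquad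 M(0)=\mathrm{Id}.$$ Let $$R_t(z)=2^{-D/2}\det\big(M_{qq}+\Gamma^{-1}M_{pp}\Gamma-iM_{qp}\Gamma+i\Gamma^{-1}M_{pq}\big)^{1/2},$$ where the branch of the square root is continuous in $t$ and $R_0(z)=1$. Let $\psi_0\in\mathcal S(\mathbb R^D)$ with $\|\psi_0\|_{L^2}=1$, and let $\hat A$ be one of $\mathrm{Id}$, $\hat q_j^{\,n}$ (multiplication by $x_j^n$), $\hat p_j^{\,n}=(-i\epsilon\partial_j)^n$ or $\hat H=-\frac{\epsilon^2}2\Delta+V$, with $n\in\mathbb N$ and $1\le j\le D$. For $w=(y,z)\in\mathbb R^{2D}\times\mathbb R^{2D}=\mathbb R^{4D}$ set $$f_0(w)=(2\pi\epsilon)^{-2D}\langle\psi_0,g_y\rangle\langle g_z,\psi_0\rangle,\qquad \Phi_t(w)=\overline{R_t(y)}\,R_t(z)\,e^{i(S_t(z)-S_t(y))/\epsilon},\qquad O_t[\hat A](w)=\langle g_{y(t)},\hat A g_{z(t)}\rangle .$$ Let $\tau>0$ and $t\in[0,\tau]$. Then $f_0\,\Phi_t\,O_t[\hat A]$ is Lebesgue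 integrable on $\mathbb R^{4D}$. Moreover, for every probability density $\rho$ on $\mathbb R^{4D}$ that is positive almost everywhere and every sequence $w_1,w_2,\dots$ of independent random points of $\mathbb R^{4D}$ with common density $\rho$, the crude Monte Carlo estimator $$A_N(t)=\frac1N\sum_{j=1}^N\frac{f_0(w_j)}{\rho(w_j)}\,\Phi_t(w_j)\,O_t[\hat A](w_j)$$ converges almost surely, as $N\to\infty$, to $$\langle\hat A\rangle_t=\int_{\mathbb R^{4D}}f_0(w)\,\Phi_t(w)\,O_t[\hat A](w)\,dw .$$ -/

import Mathlib

open MeasureTheory ProbabilityTheory Filter Topology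
open scoped ComplexConjugate ContDiff SchwartzMap

noncomputable section

namespace HermanKluk

/-- Configuration space `ℝ^D` with its Euclidean norm and Lebesgue measure. -/
abbrev Config (D : ℕ) : Type := EuclideanSpace ℝ (Fin D)

/-- Phase space `ℝ^{2D}`; a point is `z = (q, p)`. -/
abbrev Phase (D : ℕ) : Type := Config D × Config D

/-- Double phase space `ℝ^{4D}`; a point is `w = (y, z)`. -/
abbrev DoublePhase (D : ℕ) : Type := Phase D × Phase D

variable {D : ℕ}

/-- A smooth potential of sub-quadratic growth: all derivatives of order at least two are
bounded. -/
def IsSubquadratic (V : Config D → ℝ) : Prop :=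
  ContDiff ℝ ∞ V ∧ ∀ k : ℕ, 2 ≤ k → ∃ C : ℝ, ∀ x, ‖iteratedFDeriv ℝ k V x‖ ≤ C

/-! ### Classical dynamics of `h(q, p) = |p|² / 2 + V(q)` -/

/-- `γ` solves Hamilton's equations `q' = p`, `p' = -∇V(q)` for all times, with `γ(0) = z`. -/
def IsTrajectory (V : Config D → ℝ) (z : Phase D) (γ : ℝ → Phase D) : Prop :=
  γ 0 = z ∧ ∀ t, HasDerivAt γ ((γ t).2, -gradient V (γ t).1) t

/-- The trajectory `t ↦ z(t)` started at `z`: the solution of Hamilton's equations.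
For sub-quadratic `V` it exists and is unique. -/
def trajectory (V : Config D → ℝ) (z : Phase D) : ℝ → Phase D :=
  Classical.epsilon (IsTrajectory V z)

/-- The classical action: `S' = |p(t)|² / 2 - V(q(t))`, `S_0(z) = 0`. -/
def action (V : Config D → ℝ) (t : ℝ) (z : Phase D) : ℝ :=
  ∫ s in (0 : ℝ)..t, (‖(trajectory V z s).2‖ ^ 2 / 2 - V (trajectory V z s).1)

/-- The Hessian matrix of `V`. -/
def hessV (V : Config D → ℝ) (x : Config D) : Matrix (Fin D) (Fin D) ℝ :=
  fun i j => iteratedFDeriv ℝ 2 V x ![EuclideanSpace.single i 1, EuclideanSpace.single j 1]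

/-- The Hessian matrix of `h(q, p) = |p|² / 2 + V(q)`; the left summand of the index type is
position, the right one momentum. -/
def hessH (V : Config D → ℝ) (z : Phase D) :
    Matrix (Fin D ⊕ Fin D) (Fin D ⊕ Fin D) ℝ :=
  Matrix.fromBlocks (hessV V z.1) 0 0 1

/-- The matrix `J = (0, Id; -Id, 0)`. -/
def symplecticJ (D : ℕ) : Matrix (Fin D ⊕ Fin D) (Fin D ⊕ Fin D) ℝ :=
  Matrix.fromBlocks 0 1 (-1) 0

/-- `M` solves `M' = J · Hess h(z(t)) · M` (entry by entry), `M(0) = Id`. -/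
def IsStability (V : Config D → ℝ) (z : Phase D)
    (M : ℝ → Matrix (Fin D ⊕ Fin D) (Fin D ⊕ Fin D) ℝ) : Prop :=
  M 0 = 1 ∧ ∀ t i j, HasDerivAt (fun s => M s i j)
    ((symplecticJ D * hessH V (trajectory V z t) * M t) i j) t

/-- The stability matrix `M(t) = ∂z(t)/∂z` along the trajectory started at `z`: the (unique)
solution of its linear differential equation. -/
def stability (V : Config D → ℝ) (z : Phase D) :
    ℝ → Matrix (Fin D ⊕ Fin D) (Fin D ⊕ Fin D) ℝ :=
  Classical.epsilon (IsStability V z)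

/-! ### The Herman–Kluk prefactor -/

/-- A real matrix regarded as a complex one. -/
def toC (A : Matrix (Fin D) (Fin D) ℝ) : Matrix (Fin D) (Fin D) ℂ := A.map Complex.ofReal

/-- `2^{-D} det(M_qq + Γ⁻¹ M_pp Γ - i M_qp Γ + i Γ⁻¹ M_pq)`, the square of the prefactor. -/
def prefactorSq (Γ : Matrix (Fin D) (Fin D) ℝ) (V : Config D → ℝ) (t : ℝ) (z : Phase D) : ℂ :=
  (1 / 2 ^ D) *
    (toC (stability V z t).toBlocks₁₁
      + toC (Γ⁻¹ * (stability V z t).toBlocks₂₂ * Γ)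
      - Complex.I • toC ((stability V z t).toBlocks₁₂ * Γ)
      + Complex.I • toC (Γ⁻¹ * (stability V z t).toBlocks₂₁)).det

/-- `r` is the branch, continuous in time and equal to `1` at time `0`, of the square root. -/
def IsPrefactorBranch (Γ : Matrix (Fin D) (Fin D) ℝ) (V : Config D → ℝ) (z : Phase D)
    (r : ℝ → ℂ) : Prop :=
  Continuous r ∧ r 0 = 1 ∧ ∀ t, r t ^ 2 = prefactorSq Γ V t z

/-- The Herman–Kluk prefactor `R_t(z)`, with the square root chosen continuously in time. Since
the determinant never vanishes, this branch exists and is unique. -/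
def prefactor (Γ : Matrix (Fin D) (Fin D) ℝ) (V : Config D → ℝ) (t : ℝ) (z : Phase D) : ℂ :=
  Classical.epsilon (IsPrefactorBranch Γ V z) t

/-! ### Gaussians, inner products and observables -/

/-- The frozen Gaussian
`g_z(x) = (det Γ / (π^D ε^D))^{1/4} exp(-(x-q)ᵀ Γ (x-q) / (2ε) + (i/ε) pᵀ(x-q))`. -/
def gaussian (ε : ℝ) (Γ : Matrix (Fin D) (Fin D) ℝ) (z : Phase D) (x : Config D) : ℂ :=
  (((Γ.det / (Real.pi ^ D * ε ^ D)) ^ (1 / 4 : ℝ) : ℝ) : ℂ) *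
    Complex.exp
      (((-(1 / (2 * ε)) * ((x - z.1).ofLp ⬝ᵥ (Γ.mulVec (x - z.1).ofLp)) : ℝ) : ℂ)
        + (Complex.I / (ε : ℂ)) * ((inner ℝ z.2 (x - z.1) : ℝ) : ℂ))

/-- The `L²` inner product, antilinear in the first argument. -/
def l2inner (φ ψ : Config D → ℂ) : ℂ := ∫ x, conj (φ x) * ψ x

/-- The partial derivative `∂_j f`. -/
def partialD (j : Fin D) (f : Config D → ℂ) (x : Config D) : ℂ :=
  fderiv ℝ f x (EuclideanSpace.single j 1)

/-- The momentum operator `p̂_j = -iε ∂_j`. -/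
def momentumOp (ε : ℝ) (j : Fin D) (f : Config D → ℂ) (x : Config D) : ℂ :=
  -Complex.I * ε * partialD j f x

/-- The observables `Id`, `q̂_j^n`, `p̂_j^n` and `Ĥ`. -/
inductive Observable (D : ℕ) : Type
  | id : Observable D
  | position (j : Fin D) (n : ℕ) : Observable D
  | momentum (j : Fin D) (n : ℕ) : Observable D
  | hamiltonian : Observable D

/-- The action of the observables on (smooth) functions; `Ĥ = -(ε²/2) Δ + V`. -/
def Observable.apply (ε : ℝ) (V : Config D → ℝ) :
    Observable D → (Config D → ℂ) → (Config D → ℂ)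
  | .id, f => f
  | .position j n, f => fun x => ((x j : ℝ) : ℂ) ^ n * f x
  | .momentum j n, f => (momentumOp ε j)^[n] f
  | .hamiltonian, f => fun x =>
      -((ε : ℂ) ^ 2 / 2) * (∑ j : Fin D, partialD j (partialD j f) x) + (V x : ℂ) * f x

/-! ### The integrand and the estimator -/

/-- `f₀(y, z) = (2πε)^{-2D} ⟨ψ₀, g_y⟩ ⟨g_z, ψ₀⟩`. -/
def f₀ (ε : ℝ) (Γ : Matrix (Fin D) (Fin D) ℝ) (ψ₀ : Config D → ℂ) (w : DoublePhase D) : ℂ :=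
  (1 / (2 * (Real.pi : ℂ) * (ε : ℂ)) ^ (2 * D)) *
    l2inner ψ₀ (gaussian ε Γ w.1) * l2inner (gaussian ε Γ w.2) ψ₀

/-- `Φ_t(y, z) = conj(R_t(y)) R_t(z) exp(i (S_t(z) - S_t(y)) / ε)`. -/
def phaseFactor (ε : ℝ) (Γ : Matrix (Fin D) (Fin D) ℝ) (V : Config D → ℝ) (t : ℝ)
    (w : DoublePhase D) : ℂ :=
  conj (prefactor Γ V t w.1) * prefactor Γ V t w.2 *
    Complex.exp (Complex.I * ((action V t w.2 - action V t w.1 : ℝ) : ℂ) / (ε : ℂ))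

/-- `O_t[Â](y, z) = ⟨g_{y(t)}, Â g_{z(t)}⟩`. -/
def overlap (ε : ℝ) (Γ : Matrix (Fin D) (Fin D) ℝ) (V : Config D → ℝ) (A : Observable D)
    (t : ℝ) (w : DoublePhase D) : ℂ :=
  l2inner (gaussian ε Γ (trajectory V w.1 t))
    (A.apply ε V (gaussian ε Γ (trajectory V w.2 t)))

/-- The integrand `f₀ Φ_t O_t[Â]`. -/
def integrand (ε : ℝ) (Γ : Matrix (Fin D) (Fin D) ℝ) (V : Config D → ℝ) (ψ₀ : Config D → ℂ)
    (A : Observable D) (t : ℝ) (w : DoublePhase D) : ℂ :=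
  f₀ ε Γ ψ₀ w * phaseFactor ε Γ V t w * overlap ε Γ V A t w

/-- The Herman–Kluk expectation value `⟨Â⟩_t = ∫ f₀ Φ_t O_t[Â] dw`. -/
def expectation (ε : ℝ) (Γ : Matrix (Fin D) (Fin D) ℝ) (V : Config D → ℝ) (ψ₀ : Config D → ℂ)
    (A : Observable D) (t : ℝ) : ℂ :=
  ∫ w : DoublePhase D, integrand ε Γ V ψ₀ A t w

/-- A probability density on double phase space, positive off a Lebesgue null set. -/
structure IsPosDensity (ρ : DoublePhase D → ℝ) : Prop where
  measurable : Measurable ρ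
  pos : ∀ᵐ w, 0 < ρ w
  integral_eq_one : ∫ w, ρ w = 1

/-- The probability measure with density `ρ`. -/
def densityMeasure (ρ : DoublePhase D → ℝ) : Measure (DoublePhase D) :=
  volume.withDensity fun w => ENNReal.ofReal (ρ w)

/-- The crude Monte Carlo estimator `A_N(t)` built from the points `w 0, …, w (N - 1)`. -/
def crudeEstimator (ε : ℝ) (Γ : Matrix (Fin D) (Fin D) ℝ) (V : Config D → ℝ)
    (ψ₀ : Config D → ℂ) (A : Observable D) (ρ : DoublePhase D → ℝ) (t : ℝ)
    (w : ℕ → DoublePhase D) (N : ℕ) : ℂ :=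
  (1 / (N : ℂ)) * ∑ j ∈ Finset.range N,
    f₀ ε Γ ψ₀ (w j) / (ρ (w j) : ℂ) * phaseFactor ε Γ V t (w j) * overlap ε Γ V A t (w j)

end HermanKluk

end

/-! The integrand is a product of three factors: the first decays rapidly, the second is bounded and
the third grows polynomially.

Decay of `f₀`: its two inner products are phase space transforms of a Schwartz function. Integrating
by parts, multiplication of `⟨g_z, ψ⟩` by `p_j + i(Γq)_j` replaces `ψ` by another Schwartz function.
As `Γ` is invertible, these symbols control `|z|`, so iteration gives decay of every order
(`exists_pow_mul_norm_l2inner_gaussian_le`).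

Boundedness of `Φ_t`: the action enters only through a phase. Since `Hess V` is bounded, Grönwall
bounds `M(t)` uniformly in `z`, and with it the determinant (`exists_norm_prefactor_le`).

Growth of the overlap: every observable multiplies a Gaussian by a symbol of polynomial growth
(`exists_isSymbol_apply_gaussian`), and `|z(t)|` grows at most linearly in `|z|`.

Measurability requires that the objects defined by choice exist and depend well on `z`. Flow and
stability matrix are Lipschitz in `z`. Symplecticity of `M` keeps the determinant away from zero
(`det_prefactorMatrix_ne_zero`), so the branch of its root equals an explicit exponential of an
integral.

Convergence is then the strong law of large numbers for the integrand divided by `ρ`, whose mean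
under `ρ dw` is the desired integral (`ae_tendsto_average_div`). -/

noncomputable section

namespace HermanKluk

/-! ### Grönwall estimates and global solutions of ordinary differential equations. -/

section ODE

variable {E : Type*} [NormedAddCommGroup E] [NormedSpace ℝ E]

/-- A two-sided Grönwall inequality. -/
lemma norm_le_gronwallBound_abs {h h' : ℝ → E} {K δ T : ℝ}
    (hh : ∀ t, HasDerivAt h (h' t) t) (hb : ∀ t, |t| ≤ T → ‖h' t‖ ≤ K * ‖h t‖ + δ)
    {t : ℝ} (ht : |t| ≤ T) : ‖h t‖ ≤ gronwallBound ‖h 0‖ K δ |t| := by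
  have key : ∀ g g' : ℝ → E, (∀ t, HasDerivAt g (g' t) t) →
      (∀ t ∈ Set.Icc 0 T, ‖g' t‖ ≤ K * ‖g t‖ + δ) →
      ∀ t ∈ Set.Icc 0 T, ‖g t‖ ≤ gronwallBound ‖g 0‖ K δ t := by
    intro g g' hg hgb t ht
    have := norm_le_gronwallBound_of_norm_deriv_right_le (f := g) (f' := g') (δ := ‖g 0‖) (K := K)
      (ε := δ) (a := 0) (b := T) (fun s _ => (hg s).continuousAt.continuousWithinAt)
      (fun s _ => (hg s).hasDerivWithinAt) le_rfl
      (fun s hs => hgb s ⟨hs.1, hs.2.le⟩) t ht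
    simpa using this
  rcases le_total 0 t with h0 | h0
  · rw [abs_of_nonneg h0] at ht ⊢
    refine key h h' hh (fun s hs => hb s ?_) t ⟨h0, ht⟩
    rw [abs_of_nonneg hs.1]
    exact hs.2
  · rw [abs_of_nonpos h0] at ht ⊢
    have := key (fun s => h (-s)) (fun s => -h' (-s))
      (fun s => by simpa [Function.comp_def] using (hh (-s)).scomp s (hasDerivAt_neg s))
      (fun s hs => by
        rw [norm_neg]
        refine hb _ ?_
        rw [abs_neg, abs_of_nonneg hs.1]
        exact hs.2) (-t) ⟨by linarith, ht⟩
    simpa using this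

/-- Since `|sinh| ≤ cosh`, integration reproduces the weight `cosh (α t)` with a gain of `1 / α`.
This makes the Picard map a contraction on the whole line, in both time directions at once. -/
lemma norm_integral_le_cosh {f : ℝ → E} {C α : ℝ} (hα : 0 < α) (hC : 0 ≤ C)
    (hf : ∀ s, ‖f s‖ ≤ C * Real.cosh (α * s)) (t : ℝ) :
    ‖∫ s in (0 : ℝ)..t, f s‖ ≤ C / α * Real.cosh (α * t) := by
  have hint : ∫ s in (0 : ℝ)..t, C * Real.cosh (α * s) = C / α * Real.sinh (α * t) := by
    have hd : ∀ s ∈ Set.uIcc 0 t, HasDerivAt (fun s => C / α * Real.sinh (α * s))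
        (C * Real.cosh (α * s)) s := by
      intro s _
      have := ((Real.hasDerivAt_sinh (α * s)).comp s
        ((hasDerivAt_id s).const_mul α)).const_mul (C / α)
      refine this.congr_deriv ?_
      field_simp
    rw [intervalIntegral.integral_eq_sub_of_hasDerivAt hd
      (Continuous.intervalIntegrable (by fun_prop) _ _)]
    simp
  have := intervalIntegral.norm_integral_le_abs_of_norm_le (μ := volume) (a := 0) (b := t)
    (f := f) (g := fun s => C * Real.cosh (α * s)) (ae_of_all _ hf)
    (Continuous.intervalIntegrable (by fun_prop) _ _)
  refine this.trans ?_
  rw [hint, abs_mul, abs_of_nonneg (by positivity)]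
  refine mul_le_mul_of_nonneg_left ?_ (by positivity)
  rw [abs_le]
  constructor
  · have := Real.exp_pos (α * t)
    have h2 := Real.cosh_add_sinh (α * t)
    linarith
  · exact (Real.sinh_lt_cosh _).le

/-- Global solvability of ordinary differential equations whose right-hand side is globally
Lipschitz in the state and bounded in time at the initial state. -/
lemma exists_global_solution [CompleteSpace E] {F : ℝ → E → E}
    (hF : Continuous (Function.uncurry F)) {K : NNReal} (hK : ∀ t, LipschitzWith K (F t))
    (x₀ : E) {B : ℝ} (hB : ∀ t, ‖F t x₀‖ ≤ B) :
    ∃ x : ℝ → E, x 0 = x₀ ∧ ∀ t, HasDerivAt x (F t (x t)) t := by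
  have hB0 : 0 ≤ B := (norm_nonneg _).trans (hB 0)
  -- Any rate above `K` works: the contraction constant will be `K / α < 1`.
  set α : ℝ := K + 1 with hαdef
  have hα : 0 < α := by positivity
  set c : ℝ → ℝ := fun t => Real.cosh (α * t) with hc
  have hcc : Continuous c := by fun_prop
  have hcpos : ∀ t, 0 < c t := fun t => Real.cosh_pos _
  have hcone : ∀ t, 1 ≤ c t := fun t => Real.one_le_cosh _
  have hcont : ∀ u : BoundedContinuousFunction ℝ E,
      Continuous fun s => F s (x₀ + c s • u s) := fun u =>
    hF.comp (continuous_id.prodMk (continuous_const.add (hcc.smul u.continuous)))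
  have hbd : ∀ u : BoundedContinuousFunction ℝ E, ∀ s,
      ‖F s (x₀ + c s • u s)‖ ≤ (B + K * ‖u‖) * c s := by
    intro u s
    have h1 := (hK s).dist_le_mul (x₀ + c s • u s) x₀
    rw [dist_eq_norm, dist_eq_norm, add_sub_cancel_left, norm_smul, Real.norm_eq_abs,
      abs_of_pos (hcpos s)] at h1
    have h2 := norm_sub_norm_le (F s (x₀ + c s • u s)) (F s x₀)
    have h3 := u.norm_coe_le_norm s
    have h4 : (K : ℝ) * (c s * ‖u s‖) ≤ K * (c s * ‖u‖) := by gcongr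
    have h5 := mul_le_mul_of_nonneg_left (hcone s) hB0
    nlinarith [hB s]
  -- The Picard map for the rescaled unknown `u = (x - x₀) / c`, which is bounded although `x` may
  -- grow exponentially.
  let P : BoundedContinuousFunction ℝ E → BoundedContinuousFunction ℝ E := fun u =>
    BoundedContinuousFunction.ofNormedAddCommGroup
      (fun t => (c t)⁻¹ • ∫ s in (0 : ℝ)..t, F s (x₀ + c s • u s))
      ((hcc.inv₀ fun t => (hcpos t).ne').smul
        (intervalIntegral.continuous_primitive (fun a b => (hcont u).intervalIntegrable a b) 0))
      ((B + K * ‖u‖) / α) (fun t => by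
        rw [norm_smul, norm_inv, Real.norm_eq_abs, abs_of_pos (hcpos t),
          inv_mul_le_iff₀ (hcpos t), mul_comm]
        exact norm_integral_le_cosh hα (by positivity) (hbd u) t)
  have hP : ∀ u t, P u t = (c t)⁻¹ • ∫ s in (0 : ℝ)..t, F s (x₀ + c s • u s) := fun u t => rfl
  have hcontr : ContractingWith (K / (K + 1)) P := by
    refine ⟨?_, LipschitzWith.of_dist_le_mul fun u v => ?_⟩
    · rw [div_lt_one (by positivity)]
      exact lt_add_one K
    · rw [BoundedContinuousFunction.dist_le (by positivity)]
      intro t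
      rw [hP, hP, dist_eq_norm, ← smul_sub, ← intervalIntegral.integral_sub
        ((hcont u).intervalIntegrable _ _) ((hcont v).intervalIntegrable _ _), norm_smul, norm_inv,
        Real.norm_eq_abs, abs_of_pos (hcpos t), inv_mul_le_iff₀ (hcpos t), mul_comm]
      have := norm_integral_le_cosh (f := fun s => F s (x₀ + c s • u s) - F s (x₀ + c s • v s))
        (C := K * dist u v) hα (by positivity) (fun s => by
          have h1 := (hK s).dist_le_mul (x₀ + c s • u s) (x₀ + c s • v s)
          rw [dist_add_left, dist_eq_norm, dist_eq_norm, ← smul_sub, norm_smul, Real.norm_eq_abs,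
            abs_of_pos (hcpos s), ← dist_eq_norm (u s)] at h1
          refine h1.trans ?_
          have h3 := BoundedContinuousFunction.dist_coe_le_dist (f := u) (g := v) s
          have h4 : (K : ℝ) * (c s * dist (u s) (v s)) ≤ K * (c s * dist u v) := by
            gcongr
          linarith) t
      refine this.trans (le_of_eq ?_)
      push_cast
      rw [← hαdef]
      ring
  obtain ⟨u, hu, -⟩ := hcontr.exists_fixedPoint 0 (edist_ne_top _ _)
  have hx : ∀ t, c t • u t = ∫ s in (0 : ℝ)..t, F s (x₀ + c s • u s) := by
    intro t
    have h : P u t = u t := by rw [hu.eq]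
    rw [← h, hP, smul_smul, mul_inv_cancel₀ (hcpos t).ne', one_smul]
  refine ⟨fun t => x₀ + c t • u t, ?_, fun t => ?_⟩
  · change x₀ + c 0 • u 0 = x₀
    rw [hx]
    simp
  · have h1 : (fun t => x₀ + c t • u t) =
        fun t => x₀ + ∫ s in (0 : ℝ)..t, F s (x₀ + c s • u s) := by
      funext t
      rw [hx]
    have h2 := (intervalIntegral.integral_hasDerivAt_right ((hcont u).intervalIntegrable 0 t)
      (hcont u).stronglyMeasurable.stronglyMeasurableAtFilter (hcont u).continuousAt).const_add x₀
    rw [← h1] at h2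
    exact h2

end ODE

end HermanKluk

end

/-! ### The classical flow, its action and its linearisation. -/

noncomputable section

namespace HermanKluk

open scoped Matrix.Norms.Operator

variable {D : ℕ}

/-! ### Regularity of sub-quadratic potentials -/

section Potential

variable {V : Config D → ℝ}

lemma IsSubquadratic.exists_lipschitzWith_fderiv (hV : IsSubquadratic V) :
    ∃ K : NNReal, LipschitzWith K (fderiv ℝ V) := by
  obtain ⟨C, hC⟩ := hV.2 2 le_rfl
  have hC0 : 0 ≤ C := (norm_nonneg _).trans (hC 0)
  lift C to NNReal using hC0
  refine ⟨C, lipschitzWith_of_nnnorm_fderiv_le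
    ((hV.1.fderiv_right (m := 1) (WithTop.coe_le_coe.2 le_top)).differentiable (by simp)) fun x => ?_⟩
  rw [← NNReal.coe_le_coe, coe_nnnorm, ← norm_iteratedFDeriv_one, norm_iteratedFDeriv_fderiv]
  exact hC x

lemma IsSubquadratic.exists_lipschitzWith_gradient (hV : IsSubquadratic V) :
    ∃ K : NNReal, LipschitzWith K (gradient V) := by
  obtain ⟨K, hK⟩ := hV.exists_lipschitzWith_fderiv
  refine ⟨K, LipschitzWith.of_dist_le_mul fun x y => ?_⟩
  unfold gradient
  rw [LinearIsometryEquiv.dist_map]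
  exact hK.dist_le_mul x y

/-- The bound on third derivatives is what makes the stability matrix Lipschitz in the initial
point. -/
lemma IsSubquadratic.exists_lipschitzWith_iteratedFDeriv_two (hV : IsSubquadratic V) :
    ∃ K : NNReal, LipschitzWith K (iteratedFDeriv ℝ 2 V) := by
  obtain ⟨C, hC⟩ := hV.2 3 (by norm_num)
  have hC0 : 0 ≤ C := (norm_nonneg _).trans (hC 0)
  lift C to NNReal using hC0
  refine ⟨C, lipschitzWith_of_nnnorm_fderiv_le
    (hV.1.differentiable_iteratedFDeriv (m := 2) (WithTop.coe_lt_coe.2 (ENat.natCast_lt_top 2))) fun x => ?_⟩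
  rw [← NNReal.coe_le_coe, coe_nnnorm, norm_fderiv_iteratedFDeriv]
  exact hC x

/-- A sub-quadratic potential grows at most quadratically. -/
lemma IsSubquadratic.exists_abs_le (hV : IsSubquadratic V) :
    ∃ C : ℝ, 0 ≤ C ∧ ∀ x, |V x| ≤ C * (1 + ‖x‖) ^ 2 := by
  obtain ⟨K, hK⟩ := hV.exists_lipschitzWith_fderiv
  refine ⟨|V 0| + ‖fderiv ℝ V 0‖ + K, by positivity, fun x => ?_⟩
  have hbd : ∀ y ∈ Metric.closedBall (0 : Config D) ‖x‖,
      ‖fderiv ℝ V y‖ ≤ ‖fderiv ℝ V 0‖ + K * ‖x‖ := by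
    intro y hy
    rw [mem_closedBall_zero_iff] at hy
    have h1 := hK.dist_le_mul y 0
    rw [dist_zero_right, dist_eq_norm] at h1
    have h2 := norm_sub_norm_le (fderiv ℝ V y) (fderiv ℝ V 0)
    have h3 : (K : ℝ) * ‖y‖ ≤ K * ‖x‖ := by gcongr
    linarith
  have h := (convex_closedBall (0 : Config D) ‖x‖).norm_image_sub_le_of_norm_fderiv_le
    (fun y _ => (hV.1.differentiable (by simp)) y) hbd
    (x := 0) (y := x) (by simp) (by simp)
  rw [sub_zero, Real.norm_eq_abs] at h
  have h4 := abs_sub_abs_le_abs_sub (V x) (V 0)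
  have h5 := norm_nonneg x
  have h6 := abs_nonneg (V 0)
  have h7 := norm_nonneg (fderiv ℝ V 0)
  have h8 : (0 : ℝ) ≤ K := K.2
  nlinarith [mul_nonneg h6 h5, mul_nonneg h7 h5, mul_nonneg h8 h5, mul_nonneg h6 (sq_nonneg ‖x‖),
    mul_nonneg h7 (sq_nonneg ‖x‖), mul_nonneg h8 (sq_nonneg ‖x‖)]

lemma hessV_apply (x : Config D) (i j : Fin D) :
    hessV V x i j =
      iteratedFDeriv ℝ 2 V x ![EuclideanSpace.single i 1, EuclideanSpace.single j 1] := rfl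

lemma abs_iteratedFDeriv_two_single_le
    (B : ContinuousMultilinearMap ℝ (fun _ : Fin 2 => Config D) ℝ) (i j : Fin D) :
    |B ![EuclideanSpace.single i 1, EuclideanSpace.single j 1]| ≤ ‖B‖ := by
  have := B.le_opNorm ![EuclideanSpace.single i 1, EuclideanSpace.single j 1]
  simpa using this

lemma hessV_transpose (hV : IsSubquadratic V) (x : Config D) :
    (hessV V x).transpose = hessV V x := by
  ext i j
  rw [Matrix.transpose_apply, hessV_apply, hessV_apply, iteratedFDeriv_two_apply,
    iteratedFDeriv_two_apply]
  exact (hV.1.contDiffAt.isSymmSndFDerivAt (by rw [minSmoothness_of_isRCLikeNormedField]; exact WithTop.coe_le_coe.2 le_top)) _ _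

end Potential

/-! ### Families of curves -/

/-- Moving first in `z` at fixed time, then in time along a fixed curve, splits the increment into a
Lipschitz term and a term continuous in `t` alone. -/
lemma continuous_uncurry_of_norm_sub_le {X E : Type*} [SeminormedAddCommGroup X]
    [SeminormedAddCommGroup E] {f : X → ℝ → E} {C : ℝ → ℝ} (hC : Continuous C)
    (hf : ∀ z, Continuous (f z)) (h : ∀ z z' t, ‖f z t - f z' t‖ ≤ C t * ‖z - z'‖) :
    Continuous (Function.uncurry f) := by
  rw [continuous_iff_continuousAt]
  rintro ⟨z₀, t₀⟩
  rw [ContinuousAt, tendsto_iff_norm_sub_tendsto_zero]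
  have hlim : Tendsto (fun p : X × ℝ => C p.2 * ‖p.1 - z₀‖ + ‖f z₀ p.2 - f z₀ t₀‖)
      (𝓝 (z₀, t₀)) (𝓝 (C t₀ * ‖z₀ - z₀‖ + ‖f z₀ t₀ - f z₀ t₀‖)) := by
    have : Continuous fun p : X × ℝ => C p.2 * ‖p.1 - z₀‖ + ‖f z₀ p.2 - f z₀ t₀‖ := by
      have := hf z₀
      fun_prop
    exact this.tendsto (z₀, t₀)
  simp only [sub_self, norm_zero, mul_zero, add_zero] at hlim
  refine squeeze_zero (fun _ => norm_nonneg _) (fun p => ?_) hlim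
  calc ‖f p.1 p.2 - f z₀ t₀‖ = ‖(f p.1 p.2 - f z₀ p.2) + (f z₀ p.2 - f z₀ t₀)‖ := by
        rw [sub_add_sub_cancel]
    _ ≤ ‖f p.1 p.2 - f z₀ p.2‖ + ‖f z₀ p.2 - f z₀ t₀‖ := norm_add_le _ _
    _ ≤ _ := by gcongr; exact h _ _ _

/-! ### The classical trajectories -/

section Trajectory

variable {V : Config D → ℝ}

/-- The Hamiltonian vector field `(q, p) ↦ (p, -∇V(q))`. -/
def hamField (V : Config D → ℝ) (z : Phase D) : Phase D := (z.2, -gradient V z.1)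

lemma IsSubquadratic.exists_lipschitzWith_hamField (hV : IsSubquadratic V) :
    ∃ K : NNReal, LipschitzWith K (hamField V) := by
  obtain ⟨K, hK⟩ := hV.exists_lipschitzWith_gradient
  exact ⟨_, LipschitzWith.prod_snd.prodMk (hK.comp LipschitzWith.prod_fst).neg⟩

/-- Existence suffices for `Classical.epsilon` to select a solution; the Lipschitz estimate below
applies to whichever solutions were selected. -/
lemma isTrajectory_trajectory (hV : IsSubquadratic V) (z : Phase D) :
    IsTrajectory V z (trajectory V z) := by
  obtain ⟨K, hK⟩ := hV.exists_lipschitzWith_hamField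
  exact Classical.epsilon_spec (exists_global_solution (F := fun _ => hamField V)
    (hK.continuous.comp continuous_snd) (fun _ => hK) z (fun _ => le_rfl))

lemma trajectory_zero (hV : IsSubquadratic V) (z : Phase D) : trajectory V z 0 = z :=
  (isTrajectory_trajectory hV z).1

lemma hasDerivAt_trajectory (hV : IsSubquadratic V) (z : Phase D) (t : ℝ) :
    HasDerivAt (trajectory V z) (hamField V (trajectory V z t)) t :=
  (isTrajectory_trajectory hV z).2 t

lemma continuous_trajectory (hV : IsSubquadratic V) (z : Phase D) :
    Continuous (trajectory V z) :=
  continuous_iff_continuousAt.2 fun t => (hasDerivAt_trajectory hV z t).continuousAt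

/-- The flow depends on its initial point in a Lipschitz manner. -/
lemma exists_norm_trajectory_sub_le (hV : IsSubquadratic V) :
    ∃ K : NNReal, ∀ z z' t,
      ‖trajectory V z t - trajectory V z' t‖ ≤ Real.exp (K * |t|) * ‖z - z'‖ := by
  obtain ⟨K, hK⟩ := hV.exists_lipschitzWith_hamField
  refine ⟨K, fun z z' t => ?_⟩
  have h := norm_le_gronwallBound_abs (K := K) (δ := 0) (T := |t|)
    (fun s => (hasDerivAt_trajectory hV z s).sub (hasDerivAt_trajectory hV z' s))
    (fun s _ => by simpa [dist_eq_norm] using hK.dist_le_mul (trajectory V z s) (trajectory V z' s))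
    (le_refl |t|)
  rw [gronwallBound_ε0] at h
  simpa [trajectory_zero hV, mul_comm] using h

lemma continuous_uncurry_trajectory (hV : IsSubquadratic V) :
    Continuous (Function.uncurry (trajectory V)) := by
  obtain ⟨K, hK⟩ := exists_norm_trajectory_sub_le hV
  exact continuous_uncurry_of_norm_sub_le (C := fun t => Real.exp (K * |t|)) (by fun_prop)
    (continuous_trajectory hV) hK

lemma continuous_trajectory_left (hV : IsSubquadratic V) (t : ℝ) :
    Continuous fun z => trajectory V z t :=
  (continuous_uncurry_trajectory hV).comp (continuous_id.prodMk continuous_const)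

lemma exists_one_add_norm_trajectory_le (hV : IsSubquadratic V) (t : ℝ) :
    ∃ C : ℝ, 0 ≤ C ∧ ∀ z, 1 + ‖trajectory V z t‖ ≤ C * (1 + ‖z‖) := by
  obtain ⟨K, hK⟩ := exists_norm_trajectory_sub_le hV
  refine ⟨1 + ‖trajectory V 0 t‖ + Real.exp (K * |t|), by positivity, fun z => ?_⟩
  have h1 := hK z 0 t
  rw [sub_zero] at h1
  have h2 := norm_sub_norm_le (trajectory V z t) (trajectory V 0 t)
  have h3 := mul_nonneg (norm_nonneg (trajectory V 0 t)) (norm_nonneg z)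
  have h4 := Real.exp_pos (K * |t|)
  nlinarith [norm_nonneg z]

lemma continuous_action (hV : IsSubquadratic V) (t : ℝ) : Continuous (action V t) := by
  have h := continuous_uncurry_trajectory hV
  have hVc := hV.1.continuous
  unfold action
  refine intervalIntegral.continuous_parametric_intervalIntegral_of_continuous' ?_ 0 t
  have : Continuous fun p : Phase D × ℝ =>
      ‖(Function.uncurry (trajectory V) p).2‖ ^ 2 / 2 - V (Function.uncurry (trajectory V) p).1 := by
    fun_prop
  exact this

end Trajectory

/-! ### The stability matrix -/

section Stability

variable {V : Config D → ℝ}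

/-- Real matrices of size `2D`. -/
abbrev PhaseMatrix (D : ℕ) : Type := Matrix (Fin D ⊕ Fin D) (Fin D ⊕ Fin D) ℝ

/-- The norm in force is the largest absolute row sum, which is submultiplicative. -/
lemma norm_matrix_le_of_forall_abs_le {n : Type*} [Fintype n] {A : Matrix n n ℝ} {b : ℝ}
    (hb : 0 ≤ b) (h : ∀ i j, |A i j| ≤ b) : ‖A‖ ≤ Fintype.card n * b := by
  lift b to NNReal using hb
  rw [Matrix.linfty_opNorm_def, ← NNReal.coe_natCast, ← NNReal.coe_mul, NNReal.coe_le_coe]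
  refine Finset.sup_le fun i _ => ?_
  calc ∑ j, ‖A i j‖₊ ≤ ∑ _j : n, b := Finset.sum_le_sum fun j _ => by
        rw [← NNReal.coe_le_coe, coe_nnnorm, Real.norm_eq_abs]; exact h i j
    _ = Fintype.card n * b := by simp

lemma hasDerivAt_phaseMatrix {M : ℝ → PhaseMatrix D} {M' : PhaseMatrix D} {t : ℝ} :
    HasDerivAt M M' t ↔ ∀ i j, HasDerivAt (fun s => M s i j) (M' i j) t := by
  refine Iff.trans (hasDerivAt_pi (E' := fun _ => (Fin D ⊕ Fin D) → ℝ)) ?_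
  simp only [hasDerivAt_pi]

/-- The generator `J · Hess h` of the linearised flow. -/
def generator (V : Config D → ℝ) (z : Phase D) : PhaseMatrix D :=
  symplecticJ D * hessH V z

lemma generator_eq_fromBlocks (z : Phase D) :
    generator V z = Matrix.fromBlocks 0 1 (-hessV V z.1) 0 := by
  simp [generator, symplecticJ, hessH, Matrix.fromBlocks_multiply]

lemma exists_norm_generator_le (hV : IsSubquadratic V) :
    ∃ B : NNReal, ∀ z, ‖generator V z‖ ≤ B := by
  obtain ⟨C, hC⟩ := hV.2 2 le_rfl
  have hC0 : 0 ≤ C := (norm_nonneg _).trans (hC 0)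
  refine ⟨⟨Fintype.card (Fin D ⊕ Fin D) * (1 + C), by positivity⟩, fun z => ?_⟩
  refine norm_matrix_le_of_forall_abs_le (by positivity) fun i j => ?_
  rw [generator_eq_fromBlocks]
  rcases i with i | i <;> rcases j with j | j
  · simp; positivity
  · simp only [Matrix.fromBlocks_apply₁₂, Matrix.one_apply]
    split_ifs <;> simp <;> positivity
  · simp only [Matrix.fromBlocks_apply₂₁, Matrix.neg_apply, abs_neg, hessV_apply]
    have := abs_iteratedFDeriv_two_single_le (iteratedFDeriv ℝ 2 V z.1) i j
    linarith [hC z.1]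
  · simp; positivity

lemma exists_norm_generator_sub_le (hV : IsSubquadratic V) :
    ∃ L : NNReal, ∀ z z', ‖generator V z - generator V z'‖ ≤ L * ‖z - z'‖ := by
  obtain ⟨K, hK⟩ := hV.exists_lipschitzWith_iteratedFDeriv_two
  refine ⟨Fintype.card (Fin D ⊕ Fin D) * K, fun z z' => ?_⟩
  push_cast
  rw [mul_assoc]
  refine norm_matrix_le_of_forall_abs_le (by positivity) fun i j => ?_
  rw [generator_eq_fromBlocks, generator_eq_fromBlocks, Matrix.sub_apply]
  rcases i with i | i <;> rcases j with j | j
  · simp; positivity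
  · simp; positivity
  · simp only [Matrix.fromBlocks_apply₂₁, Matrix.neg_apply, hessV_apply]
    rw [← abs_neg, neg_sub_neg, neg_sub, ← sub_apply]
    refine (abs_iteratedFDeriv_two_single_le _ i j).trans ?_
    have h1 := hK.dist_le_mul z.1 z'.1
    rw [dist_eq_norm, dist_eq_norm] at h1
    refine h1.trans ?_
    gcongr
    exact norm_fst_le (z - z')
  · simp; positivity

lemma continuous_generator (hV : IsSubquadratic V) : Continuous (generator V) := by
  obtain ⟨L, hL⟩ := exists_norm_generator_sub_le hV
  exact (LipschitzWith.of_dist_le_mul (K := L) fun z z' => by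
    rw [dist_eq_norm, dist_eq_norm]; exact hL z z').continuous

lemma isStability_stability (hV : IsSubquadratic V) (z : Phase D) :
    IsStability V z (stability V z) := by
  obtain ⟨B, hB⟩ := exists_norm_generator_le hV
  have hX : Continuous fun t => generator V (trajectory V z t) :=
    (continuous_generator hV).comp (continuous_trajectory hV z)
  obtain ⟨M, hM0, hM⟩ := exists_global_solution
    (F := fun t (M : PhaseMatrix D) => generator V (trajectory V z t) * M)
    ((hX.comp continuous_fst).mul continuous_snd) (K := B)
    (fun t => LipschitzWith.of_dist_le_mul fun M N => by
      rw [dist_eq_norm, dist_eq_norm, ← mul_sub]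
      exact (norm_mul_le _ _).trans (mul_le_mul_of_nonneg_right (hB _) (norm_nonneg _)))
    1 (B := B) (fun t => by rw [mul_one]; exact hB _)
  exact Classical.epsilon_spec (p := IsStability V z)
    ⟨M, hM0, fun t i j => hasDerivAt_phaseMatrix.1 (hM t) i j⟩

lemma stability_zero (hV : IsSubquadratic V) (z : Phase D) : stability V z 0 = 1 :=
  (isStability_stability hV z).1

lemma hasDerivAt_stability (hV : IsSubquadratic V) (z : Phase D) (t : ℝ) :
    HasDerivAt (stability V z) (generator V (trajectory V z t) * stability V z t) t :=
  hasDerivAt_phaseMatrix.2 fun i j => (isStability_stability hV z).2 t i j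

lemma continuous_stability (hV : IsSubquadratic V) (z : Phase D) :
    Continuous (stability V z) :=
  continuous_iff_continuousAt.2 fun t => (hasDerivAt_stability hV z t).continuousAt

lemma exists_norm_stability_le (hV : IsSubquadratic V) :
    ∃ B : NNReal, ∀ z t, ‖stability V z t‖ ≤ ‖(1 : PhaseMatrix D)‖ * Real.exp (B * |t|) := by
  obtain ⟨B, hB⟩ := exists_norm_generator_le hV
  refine ⟨B, fun z t => ?_⟩
  have h := norm_le_gronwallBound_abs (K := B) (δ := 0) (T := |t|) (hasDerivAt_stability hV z)
    (fun s _ => by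
      rw [add_zero]
      exact (norm_mul_le _ _).trans (mul_le_mul_of_nonneg_right (hB _) (norm_nonneg _)))
    (le_refl |t|)
  rwa [gronwallBound_ε0, stability_zero hV] at h

lemma exists_norm_stability_sub_le (hV : IsSubquadratic V) :
    ∃ C : ℝ → ℝ, Continuous C ∧
      ∀ z z' t, ‖stability V z t - stability V z' t‖ ≤ C t * ‖z - z'‖ := by
  obtain ⟨K, hK⟩ := exists_norm_trajectory_sub_le hV
  obtain ⟨B₀, hB₀⟩ := exists_norm_generator_le hV
  obtain ⟨L, hL⟩ := exists_norm_generator_sub_le hV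
  obtain ⟨N, hN⟩ := exists_norm_stability_le hV
  -- The added one ensures `B ≠ 0`, so that `gronwallBound` takes its exponential form with the
  -- quotient by `B`.
  set B : NNReal := B₀ + 1 with hBdef
  have hB : ∀ z, ‖generator V z‖ ≤ B := fun z => (hB₀ z).trans (by simp [hBdef])
  have hBpos : (0 : ℝ) < B := by rw [hBdef]; push_cast; positivity
  refine ⟨fun t => L * Real.exp (K * |t|) * (‖(1 : PhaseMatrix D)‖ * Real.exp (N * |t|)) / B *
    (Real.exp (B * |t|) - 1), by fun_prop, fun z z' t => ?_⟩
  -- The difference of two stability matrices solves the linear equation with a source due to the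
  -- difference of generators. On `|s| ≤ |t|` the source is bounded by its estimate at `|t|`, and
  -- the initial difference is zero.
  have h := norm_le_gronwallBound_abs (K := B)
    (δ := L * (Real.exp (K * |t|) * ‖z - z'‖) * (‖(1 : PhaseMatrix D)‖ * Real.exp (N * |t|)))
    (T := |t|)
    (fun s => (hasDerivAt_stability hV z s).sub (hasDerivAt_stability hV z' s))
    (fun s hs => by
      have e : generator V (trajectory V z s) * stability V z s
          - generator V (trajectory V z' s) * stability V z' s
          = generator V (trajectory V z s) * (stability V z s - stability V z' s)
          + (generator V (trajectory V z s) - generator V (trajectory V z' s))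
            * stability V z' s := by noncomm_ring
      rw [e]
      refine (norm_add_le _ _).trans (add_le_add ?_ ?_)
      · exact (norm_mul_le _ _).trans (mul_le_mul_of_nonneg_right (hB _) (norm_nonneg _))
      · refine (norm_mul_le _ _).trans (mul_le_mul ?_ ?_ (norm_nonneg _) (by positivity))
        · refine (hL _ _).trans (mul_le_mul_of_nonneg_left ((hK z z' s).trans ?_) L.2)
          gcongr
        · refine (hN z' s).trans ?_
          gcongr)
    (le_refl |t|)
  rw [gronwallBound_of_K_ne_0 hBpos.ne'] at h
  simp only [Pi.sub_apply, stability_zero hV, sub_self, norm_zero, zero_mul, zero_add] at h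
  refine h.trans (le_of_eq ?_)
  ring

lemma continuous_uncurry_stability (hV : IsSubquadratic V) :
    Continuous (Function.uncurry (stability V)) := by
  obtain ⟨C, hC, h⟩ := exists_norm_stability_sub_le hV
  exact continuous_uncurry_of_norm_sub_le hC (continuous_stability hV) h

end Stability

end HermanKluk

end

/-! ### The Herman–Kluk prefactor: nonvanishing, choice of branch, measurability and bounds. -/

noncomputable section

namespace HermanKluk

open scoped Matrix.Norms.Operator Matrix

variable {D : ℕ} {Γ : Matrix (Fin D) (Fin D) ℝ} {V : Config D → ℝ}

/-! ### Symplecticity of the stability matrix -/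

/-- `J · Hess h` lies in the symplectic Lie algebra because the Hessian is symmetric; this is the
infinitesimal form of symplecticity. -/
lemma generator_transpose_mul_add (hV : IsSubquadratic V) (z : Phase D) :
    (generator V z)ᵀ * symplecticJ D + symplecticJ D * generator V z = 0 := by
  rw [generator_eq_fromBlocks, symplecticJ, Matrix.fromBlocks_transpose,
    Matrix.fromBlocks_multiply, Matrix.fromBlocks_multiply, Matrix.fromBlocks_add,
    Matrix.transpose_neg, hessV_transpose hV, ← Matrix.fromBlocks_zero]
  simp

/-- The stability matrix is symplectic. -/
lemma stability_symplectic (hV : IsSubquadratic V) (z : Phase D) (t : ℝ) :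
    (stability V z t)ᵀ * symplecticJ D * stability V z t = symplecticJ D := by
  have hd : ∀ s, HasDerivAt
      (fun s => (stability V z s)ᵀ * symplecticJ D * stability V z s) 0 s := by
    intro s
    have h := hasDerivAt_stability hV z s
    have hT : HasDerivAt (fun s => (stability V z s)ᵀ)
        (generator V (trajectory V z s) * stability V z s)ᵀ s :=
      hasDerivAt_phaseMatrix.2 fun i j => hasDerivAt_phaseMatrix.1 h j i
    refine ((hT.mul_const (symplecticJ D)).mul h).congr_deriv ?_
    rw [Matrix.transpose_mul]
    calc _ = (stability V z s)ᵀ * ((generator V (trajectory V z s))ᵀ * symplecticJ D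
          + symplecticJ D * generator V (trajectory V z s)) * stability V z s := by noncomm_ring
      _ = 0 := by rw [generator_transpose_mul_add hV]; simp
  have h := is_const_of_deriv_eq_zero (fun s => (hd s).differentiableAt)
    (fun s => (hd s).deriv) t 0
  simpa [stability_zero hV] using h

/-! ### The prefactor never vanishes -/

/-- The matrix whose determinant is the square of the prefactor, up to normalisation. -/
def prefactorMatrix (Γ : Matrix (Fin D) (Fin D) ℝ) (M : PhaseMatrix D) :
    Matrix (Fin D) (Fin D) ℂ :=
  toC M.toBlocks₁₁ + toC (Γ⁻¹ * M.toBlocks₂₂ * Γ) - Complex.I • toC (M.toBlocks₁₂ * Γ)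
    + Complex.I • toC (Γ⁻¹ * M.toBlocks₂₁)

lemma prefactorSq_eq (t : ℝ) (z : Phase D) :
    prefactorSq Γ V t z = (1 / 2 ^ D) * (prefactorMatrix Γ (stability V z t)).det := rfl

lemma toC_mul (A B : Matrix (Fin D) (Fin D) ℝ) : toC (A * B) = toC A * toC B :=
  Matrix.map_mul (f := Complex.ofRealHom)

/-- The cross terms between real and imaginary parts of `v` are purely imaginary. -/
lemma re_star_dotProduct_toC_mulVec (A : Matrix (Fin D) (Fin D) ℝ) (v : Fin D → ℂ) :
    (star v ⬝ᵥ (toC A *ᵥ v)).re = (fun i => (v i).re) ⬝ᵥ (A *ᵥ fun i => (v i).re)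
      + (fun i => (v i).im) ⬝ᵥ (A *ᵥ fun i => (v i).im) := by
  simp [dotProduct, Matrix.mulVec, toC, Complex.mul_re, ← Finset.sum_add_distrib]

lemma re_star_dotProduct_toC_mulVec_pos (hΓ : Γ.PosDef) {v : Fin D → ℂ} (hv : v ≠ 0) :
    0 < (star v ⬝ᵥ (toC Γ *ᵥ v)).re := by
  rw [re_star_dotProduct_toC_mulVec]
  have h0 : ∀ x : Fin D → ℝ, 0 ≤ x ⬝ᵥ (Γ *ᵥ x) := fun x => by
    simpa using hΓ.posSemidef.dotProduct_mulVec_nonneg x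
  have h1 : ∀ x : Fin D → ℝ, x ≠ 0 → 0 < x ⬝ᵥ (Γ *ᵥ x) := fun x hx => by
    simpa using hΓ.dotProduct_mulVec_pos hx
  by_cases hre : (fun i => (v i).re) = 0
  · have him : (fun i => (v i).im) ≠ 0 := fun him => hv <| by
      funext i
      exact Complex.ext (congrFun hre i) (congrFun him i)
    exact add_pos_of_nonneg_of_pos (h0 _) (h1 _ him)
  · exact add_pos_of_pos_of_nonneg (h1 _ hre) (h0 _)

/-- The sesquilinear extension of the symplectic form is preserved by symplectic matrices. -/
lemma star_dotProduct_symplecticJ_mulVec {M : PhaseMatrix D}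
    (hM : Mᵀ * symplecticJ D * M = symplecticJ D) (W : Fin D ⊕ Fin D → ℂ) :
    star (M.map Complex.ofReal *ᵥ W) ⬝ᵥ
        ((symplecticJ D).map Complex.ofReal *ᵥ (M.map Complex.ofReal *ᵥ W))
      = star W ⬝ᵥ ((symplecticJ D).map Complex.ofReal *ᵥ W) := by
  have hc : (M.map Complex.ofReal)ᴴ * (symplecticJ D).map Complex.ofReal * M.map Complex.ofReal
      = (symplecticJ D).map Complex.ofReal := by
    have hH : (M.map Complex.ofReal)ᴴ = Mᵀ.map Complex.ofRealHom := by
      ext i j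
      simp
    have h := congrArg (fun A : PhaseMatrix D => A.map Complex.ofRealHom) hM
    simp only [Matrix.map_mul] at h
    rw [hH]
    exact h
  rw [Matrix.star_mulVec, ← Matrix.dotProduct_mulVec, Matrix.mulVec_mulVec, Matrix.mulVec_mulVec,
    hc]

lemma star_sumElim_dotProduct_symplecticJ (a b : Fin D → ℂ) :
    star (Sum.elim a b) ⬝ᵥ ((symplecticJ D).map Complex.ofReal *ᵥ Sum.elim a b)
      = star a ⬝ᵥ b - star b ⬝ᵥ a := by
  have : (symplecticJ D).map Complex.ofReal
      = Matrix.fromBlocks 0 1 (-1) (0 : Matrix (Fin D) (Fin D) ℂ) := by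
    ext i j
    rcases i with i | i <;> rcases j with j | j <;> simp [symplecticJ, Matrix.one_apply] <;>
      split_ifs <;> simp
  rw [this, Matrix.fromBlocks_mulVec]
  simp [dotProduct, sub_eq_add_neg, Matrix.neg_mulVec]

lemma star_mulVec_dotProduct_toC (hΓ : Γ.PosDef) (v : Fin D → ℂ) :
    star (toC Γ *ᵥ v) ⬝ᵥ v = star v ⬝ᵥ (toC Γ *ᵥ v) := by
  have hH : (toC Γ)ᴴ = toC Γ := by
    ext i j
    have := congrFun (congrFun hΓ.isHermitian i) j
    simp only [Matrix.conjTranspose_apply, star_trivial] at this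
    simp [toC, this]
  rw [Matrix.star_mulVec, hH, ← Matrix.dotProduct_mulVec]

/-- A sign argument. If `v ≠ 0` is in the kernel, `M` maps `(v, -iΓv)` to a vector `(a, b)` with `a
+ iΓ⁻¹b = 0`, that is `b = iΓa`. The sesquilinear symplectic form equals `-2i v*Γv` on the first
vector and `2i a*Γa` on the second. Its invariance contradicts `v*Γv > 0` and `a*Γa ≥ 0`. -/
lemma det_prefactorMatrix_ne_zero (hΓ : Γ.PosDef) {M : PhaseMatrix D}
    (hM : Mᵀ * symplecticJ D * M = symplecticJ D) : (prefactorMatrix Γ M).det ≠ 0 := by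
  intro hdet
  obtain ⟨v, hv, hv0⟩ := Matrix.exists_mulVec_eq_zero_iff.2 hdet
  set w : Fin D → ℂ := -Complex.I • (toC Γ *ᵥ v) with hw
  set a : Fin D → ℂ := toC M.toBlocks₁₁ *ᵥ v + toC M.toBlocks₁₂ *ᵥ w with ha
  set b : Fin D → ℂ := toC M.toBlocks₂₁ *ᵥ v + toC M.toBlocks₂₂ *ᵥ w with hb
  have hinv : toC Γ * toC Γ⁻¹ = 1 := by
    rw [← toC_mul, Matrix.mul_nonsing_inv _ ((Matrix.isUnit_iff_isUnit_det _).1 hΓ.isUnit)]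
    ext i j
    simp only [toC, Matrix.map_apply, Matrix.one_apply]
    split_ifs <;> simp
  have hU : M.map Complex.ofReal *ᵥ Sum.elim v w = Sum.elim a b := by
    conv_lhs => rw [← Matrix.fromBlocks_toBlocks M]
    rw [Matrix.fromBlocks_map, Matrix.fromBlocks_mulVec]
    rfl
  have h1 : prefactorMatrix Γ M *ᵥ v = a + Complex.I • (toC Γ⁻¹ *ᵥ b) := by
    simp only [prefactorMatrix, ha, hb, hw, toC_mul, Matrix.add_mulVec, Matrix.sub_mulVec,
      Matrix.smul_mulVec, Matrix.mulVec_add, Matrix.mulVec_smul, smul_add, smul_smul,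
      ← Matrix.mulVec_mulVec, Complex.I_mul_I, neg_neg, neg_smul, one_smul,
      Matrix.mulVec_neg, smul_neg]
    abel
  have h2 : b = Complex.I • (toC Γ *ᵥ a) := by
    have h3 := congrArg (fun u => Complex.I • (toC Γ *ᵥ u)) (h1.symm.trans hv0)
    simp only [Matrix.mulVec_add, Matrix.mulVec_smul, Matrix.mulVec_mulVec, hinv,
      Matrix.one_mulVec, smul_add, smul_smul, Complex.I_mul_I, Matrix.mulVec_zero, smul_zero,
      neg_smul, one_smul] at h3
    exact (add_neg_eq_zero.1 h3).symm
  have h4 := star_dotProduct_symplecticJ_mulVec hM (Sum.elim v w)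
  rw [hU, star_sumElim_dotProduct_symplecticJ, star_sumElim_dotProduct_symplecticJ, h2, hw] at h4
  simp only [star_smul, dotProduct_smul, smul_dotProduct, star_mulVec_dotProduct_toC hΓ,
    Complex.star_def, map_neg, Complex.conj_I, smul_eq_mul, neg_neg] at h4
  have h5 := congrArg Complex.im h4
  simp only [Complex.sub_im, Complex.mul_im, Complex.neg_im, Complex.neg_re, Complex.I_re,
    Complex.I_im] at h5
  have h6 := re_star_dotProduct_toC_mulVec_pos hΓ hv
  have h7 : 0 ≤ (star a ⬝ᵥ (toC Γ *ᵥ a)).re := by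
    by_cases ha0 : a = 0
    · simp [ha0]
    · exact (re_star_dotProduct_toC_mulVec_pos hΓ ha0).le
  linarith

/-! ### The continuous branch of the square root -/

lemma prefactorSq_ne_zero (hΓ : Γ.PosDef) (hV : IsSubquadratic V) (t : ℝ) (z : Phase D) :
    prefactorSq Γ V t z ≠ 0 := by
  rw [prefactorSq_eq]
  exact mul_ne_zero (by simp) (det_prefactorMatrix_ne_zero hΓ (stability_symplectic hV z t))

/-- At `M = Id` the matrix is `2 Id`, whose determinant the normalisation `2^{-D}` cancels. -/
lemma prefactorSq_zero (hΓ : Γ.PosDef) (hV : IsSubquadratic V) (z : Phase D) :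
    prefactorSq Γ V 0 z = 1 := by
  have h : prefactorMatrix Γ (1 : PhaseMatrix D) = (2 : ℂ) • 1 := by
    have h1 : toC (1 : Matrix (Fin D) (Fin D) ℝ) = 1 := by
      ext i j
      simp only [toC, Matrix.map_apply, Matrix.one_apply]
      split_ifs <;> simp
    have h0 : toC (0 : Matrix (Fin D) (Fin D) ℝ) = 0 := by
      ext i j
      simp [toC]
    rw [prefactorMatrix, ← Matrix.fromBlocks_one]
    simp only [Matrix.toBlocks_fromBlocks₁₁, Matrix.toBlocks_fromBlocks₁₂,
      Matrix.toBlocks_fromBlocks₂₁, Matrix.toBlocks_fromBlocks₂₂, mul_one, Matrix.mul_zero,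
      Matrix.zero_mul, Matrix.nonsing_inv_mul _ ((Matrix.isUnit_iff_isUnit_det _).1 hΓ.isUnit),
      h0, h1, smul_zero, sub_zero, add_zero, two_smul]
  rw [prefactorSq_eq, stability_zero hV, h, Matrix.det_smul]
  simp

lemma continuous_prefactorMatrix :
    Continuous fun M : PhaseMatrix D => prefactorMatrix Γ M := by
  refine continuous_matrix fun i j => ?_
  have h : ∀ i j, Continuous fun M : PhaseMatrix D => M i j := fun i j =>
    continuous_id.matrix_elem i j
  simp only [prefactorMatrix, toC, Matrix.toBlocks₁₁, Matrix.toBlocks₁₂, Matrix.toBlocks₂₁,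
    Matrix.toBlocks₂₂, Matrix.add_apply, Matrix.sub_apply, Matrix.smul_apply, Matrix.map_apply,
    Matrix.mul_apply, Matrix.of_apply]
  fun_prop

lemma continuous_uncurry_prefactorSq (hV : IsSubquadratic V) :
    Continuous (Function.uncurry fun z t => prefactorSq Γ V t z) := by
  have h : Continuous fun p : Phase D × ℝ =>
      (1 / 2 ^ D : ℂ) * (prefactorMatrix Γ (Function.uncurry (stability V) p)).det :=
    continuous_const.mul
      (continuous_prefactorMatrix.comp (continuous_uncurry_stability hV)).matrix_det
  exact h

lemma contDiff_prefactorSq (hV : IsSubquadratic V) (z : Phase D) :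
    ContDiff ℝ 1 fun t => prefactorSq Γ V t z := by
  have hX : Continuous fun t => generator V (trajectory V z t) * stability V z t :=
    ((continuous_generator hV).comp (continuous_trajectory hV z)).mul (continuous_stability hV z)
  have h : ∀ i j, ContDiff ℝ 1 fun t => stability V z t i j := fun i j => by
    rw [contDiff_one_iff_deriv]
    have hd : ∀ t, HasDerivAt (fun t => stability V z t i j)
        ((generator V (trajectory V z t) * stability V z t) i j) t :=
      fun t => hasDerivAt_phaseMatrix.1 (hasDerivAt_stability hV z t) i j
    refine ⟨fun t => (hd t).differentiableAt, ?_⟩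
    rw [funext fun t => (hd t).deriv]
    exact hX.matrix_elem i j
  have hc : ∀ {f : ℝ → ℝ}, ContDiff ℝ 1 f → ContDiff ℝ 1 fun t => (f t : ℂ) :=
    fun hf => Complex.ofRealCLM.contDiff.comp hf
  have he : ∀ i j, ContDiff ℝ 1 fun t => prefactorMatrix Γ (stability V z t) i j := by
    intro i j
    simp only [prefactorMatrix, toC, Matrix.toBlocks₁₁, Matrix.toBlocks₁₂, Matrix.toBlocks₂₁,
      Matrix.toBlocks₂₂, Matrix.add_apply, Matrix.sub_apply, Matrix.smul_apply, Matrix.map_apply,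
      Matrix.mul_apply, Matrix.of_apply, smul_eq_mul]
    have h11 : ContDiff ℝ 1 fun t => stability V z t (Sum.inl i) (Sum.inl j) := h _ _
    refine (((hc h11).add (hc ?_)).sub (contDiff_const.mul (hc ?_))).add
      (contDiff_const.mul (hc ?_))
    · exact ContDiff.sum fun k _ => (ContDiff.sum fun l _ => contDiff_const.mul (h _ _)).mul
        contDiff_const
    · exact ContDiff.sum fun k _ => (h _ _).mul contDiff_const
    · exact ContDiff.sum fun k _ => contDiff_const.mul (h _ _)
  simp only [prefactorSq_eq, Matrix.det_apply']
  refine contDiff_const.mul (ContDiff.sum fun σ _ => ?_)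
  exact contDiff_const.mul (contDiff_prod fun k _ => he _ _)

/-- An explicit logarithmic formula for the prefactor. -/
def prefactorExp (Γ : Matrix (Fin D) (Fin D) ℝ) (V : Config D → ℝ) (z : Phase D) (t : ℝ) : ℂ :=
  Complex.exp (1 / 2 * ∫ s in (0 : ℝ)..t,
    deriv (fun s => prefactorSq Γ V s z) s / prefactorSq Γ V s z)

lemma isPrefactorBranch_prefactorExp (hΓ : Γ.PosDef) (hV : IsSubquadratic V) (z : Phase D) :
    IsPrefactorBranch Γ V z (prefactorExp Γ V z) := by
  have hc1 := contDiff_prefactorSq (Γ := Γ) hV z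
  have hc0 : ∀ s, prefactorSq Γ V s z ≠ 0 := fun s => prefactorSq_ne_zero hΓ hV s z
  have hlog : Continuous fun s => deriv (fun s => prefactorSq Γ V s z) s / prefactorSq Γ V s z :=
    (hc1.continuous_deriv le_rfl).div hc1.continuous hc0
  have hint : ∀ t, HasDerivAt (fun t => ∫ s in (0 : ℝ)..t,
      deriv (fun s => prefactorSq Γ V s z) s / prefactorSq Γ V s z)
      (deriv (fun s => prefactorSq Γ V s z) t / prefactorSq Γ V t z) t := fun t =>
    intervalIntegral.integral_hasDerivAt_right (hlog.intervalIntegrable 0 t)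
      hlog.stronglyMeasurable.stronglyMeasurableAtFilter hlog.continuousAt
  have hcont : Continuous fun t => ∫ s in (0 : ℝ)..t,
      deriv (fun s => prefactorSq Γ V s z) s / prefactorSq Γ V s z :=
    continuous_iff_continuousAt.2 fun t => (hint t).continuousAt
  refine ⟨Complex.continuous_exp.comp (continuous_const.mul hcont), by simp [prefactorExp],
    fun t => ?_⟩
  -- With `d` the squared prefactor, `d · exp(-∫ d'/d)` is constant, equal to its value `1` at time
  -- zero; hence `d = exp(∫ d'/d)`, the square of `prefactorExp`.
  have hd : ∀ t, HasDerivAt (fun t => prefactorSq Γ V t z * Complex.exp (-∫ s in (0 : ℝ)..t,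
      deriv (fun s => prefactorSq Γ V s z) s / prefactorSq Γ V s z)) 0 t := by
    intro t
    have h1 := (hc1.differentiable one_ne_zero t).hasDerivAt.mul (hint t).neg.cexp
    refine h1.congr_deriv ?_
    have := hc0 t
    field_simp
    ring
  have hconst := is_const_of_deriv_eq_zero (fun s => (hd s).differentiableAt)
    (fun s => (hd s).deriv) t 0
  simp only [intervalIntegral.integral_same, neg_zero, Complex.exp_zero, mul_one,
    prefactorSq_zero hΓ hV, Complex.exp_neg] at hconst
  rw [prefactorExp, ← Complex.exp_nat_mul]
  rw [mul_inv_eq_one₀ (Complex.exp_ne_zero _)] at hconst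
  rw [hconst]
  congr 1
  push_cast
  ring

lemma isPrefactorBranch_prefactor (hΓ : Γ.PosDef) (hV : IsSubquadratic V) (z : Phase D) :
    IsPrefactorBranch Γ V z fun t => prefactor Γ V t z :=
  Classical.epsilon_spec ⟨_, isPrefactorBranch_prefactorExp hΓ hV z⟩

/-- Two continuous square roots of a nonvanishing function on a connected set agree everywhere if
they agree at one point. Measurability in `z`, invisible in a pointwise choice, can then be read off
the formula. -/
lemma prefactor_eq_prefactorExp (hΓ : Γ.PosDef) (hV : IsSubquadratic V) (z : Phase D) (t : ℝ) :
    prefactor Γ V t z = prefactorExp Γ V z t := by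
  obtain ⟨h1, h2, h3⟩ := isPrefactorBranch_prefactor hΓ hV z
  obtain ⟨k1, k2, k3⟩ := isPrefactorBranch_prefactorExp hΓ hV z
  exact isPreconnected_univ.eq_of_sq_eq (f := fun t => prefactor Γ V t z) h1.continuousOn
    k1.continuousOn (fun s _ => (h3 s).trans (k3 s).symm) (fun _ => Complex.exp_ne_zero _)
    (Set.mem_univ 0) (h2.trans k2.symm) (Set.mem_univ t)

lemma measurable_prefactor (hΓ : Γ.PosDef) (hV : IsSubquadratic V) (t : ℝ) :
    Measurable (prefactor Γ V t) := by
  rw [funext fun z => prefactor_eq_prefactorExp hΓ hV z t]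
  have hm : Measurable fun p : Phase D × ℝ =>
      deriv (fun s => prefactorSq Γ V s p.1) p.2 / prefactorSq Γ V p.2 p.1 :=
    (measurable_deriv_with_param (continuous_uncurry_prefactorSq hV)).div
      (continuous_uncurry_prefactorSq hV).measurable
  refine Complex.measurable_exp.comp (Measurable.const_mul ?_ _)
  -- An interval integral is by definition a difference of two set integrals.
  exact (hm.stronglyMeasurable.integral_prod_right.sub
    hm.stronglyMeasurable.integral_prod_right).measurable

lemma exists_norm_prefactor_le (hΓ : Γ.PosDef) (hV : IsSubquadratic V) (t : ℝ) :
    ∃ C : ℝ, 0 ≤ C ∧ ∀ z, ‖prefactor Γ V t z‖ ≤ C := by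
  obtain ⟨B, hB⟩ := exists_norm_stability_le hV
  have : ProperSpace (PhaseMatrix D) := FiniteDimensional.proper_real _
  -- All stability matrices at time `t` lie in one compact ball independent of `z`, where the
  -- continuous determinant is bounded.
  obtain ⟨C, hC⟩ := (isCompact_closedBall (0 : PhaseMatrix D)
    (‖(1 : PhaseMatrix D)‖ * Real.exp (B * |t|))).exists_bound_of_continuousOn
    (continuous_const.mul (continuous_prefactorMatrix (Γ := Γ)).matrix_det
      (f := fun _ => (1 / 2 ^ D : ℂ))).continuousOn
  have hC' : ∀ z, ‖prefactor Γ V t z‖ ^ 2 ≤ C := fun z => by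
    rw [← norm_pow, (isPrefactorBranch_prefactor hΓ hV z).2.2 t, prefactorSq_eq]
    exact hC _ (mem_closedBall_zero_iff.2 (hB z t))
  have hC0 : 0 ≤ C := (sq_nonneg _).trans (hC' 0)
  exact ⟨1 + C, by positivity, fun z => by
    nlinarith [hC' z, sq_nonneg (‖prefactor Γ V t z‖ - 1), norm_nonneg (prefactor Γ V t z)]⟩

end HermanKluk

end

/-! ### Size and derivatives of the frozen Gaussians. -/

noncomputable section

namespace HermanKluk

open scoped Matrix

variable {D : ℕ} {ε : ℝ} {Γ : Matrix (Fin D) (Fin D) ℝ} {V : Config D → ℝ}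

/-! ### Polynomial weights -/

lemma integrable_inv_one_add_norm_pow {E : Type*} [NormedAddCommGroup E] [NormedSpace ℝ E]
    [FiniteDimensional ℝ E] [MeasurableSpace E] [BorelSpace E] {μ : Measure E} [μ.IsAddHaarMeasure]
    {n : ℕ} (hn : Module.finrank ℝ E < n) : Integrable (fun x : E => ((1 + ‖x‖) ^ n)⁻¹) μ := by
  refine (integrable_one_add_norm (μ := μ) (r := n) (by exact_mod_cast hn)).congr
    (ae_of_all _ fun x => ?_)
  simp only [Real.rpow_neg (by positivity : (0 : ℝ) ≤ 1 + ‖x‖), Real.rpow_natCast]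

lemma one_add_pow_mul_exp_neg_le (n : ℕ) {a : ℝ} (ha : 0 < a) :
    ∃ C : ℝ, 0 ≤ C ∧ ∀ r : ℝ, 0 ≤ r → (1 + r) ^ n * Real.exp (-(a * r ^ 2)) ≤ C := by
  -- From `(1 + r)^n ≤ n! exp(1 + r)` and, completing the square, `r - a r² ≤ 1 / (4a)`.
  refine ⟨n.factorial * Real.exp (1 + 1 / (4 * a)), by positivity, fun r hr => ?_⟩
  have h1 : (1 + r) ^ n ≤ n.factorial * Real.exp (1 + r) := by
    have := Real.pow_div_factorial_le_exp (1 + r) (by positivity) n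
    rwa [div_le_iff₀' (by positivity)] at this
  have h2 : (1 + r) + -(a * r ^ 2) ≤ 1 + 1 / (4 * a) := by
    have : 1 / (4 * a) - r + a * r ^ 2 = a * (r - 1 / (2 * a)) ^ 2 := by
      field_simp
      ring
    nlinarith [mul_nonneg ha.le (sq_nonneg (r - 1 / (2 * a)))]
  calc (1 + r) ^ n * Real.exp (-(a * r ^ 2))
      ≤ n.factorial * Real.exp (1 + r) * Real.exp (-(a * r ^ 2)) := by gcongr
    _ = n.factorial * Real.exp ((1 + r) + -(a * r ^ 2)) := by rw [Real.exp_add (1 + r)]; ring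
    _ ≤ _ := by gcongr

/-! ### Size of the Gaussians -/

lemma continuous_quadraticForm :
    Continuous fun u : Config D => u.ofLp ⬝ᵥ (Γ *ᵥ u.ofLp) := by
  simp only [dotProduct, Matrix.mulVec]
  fun_prop

/-- The constant is the minimum of the form on the unit sphere, extended by homogeneity. -/
lemma exists_mul_norm_sq_le (hΓ : Γ.PosDef) :
    ∃ a : ℝ, 0 < a ∧ ∀ u : Config D, a * ‖u‖ ^ 2 ≤ u.ofLp ⬝ᵥ (Γ *ᵥ u.ofLp) := by
  have hpos : ∀ u : Config D, u ≠ 0 → 0 < u.ofLp ⬝ᵥ (Γ *ᵥ u.ofLp) := fun u hu => by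
    simpa using hΓ.dotProduct_mulVec_pos (x := u.ofLp) (by simpa using hu)
  by_cases hne : (Metric.sphere (0 : Config D) 1).Nonempty
  · obtain ⟨v, hv, hmin⟩ := (isCompact_sphere (0 : Config D) 1).exists_isMinOn hne
      (continuous_quadraticForm (Γ := Γ)).continuousOn
    rw [mem_sphere_zero_iff_norm] at hv
    refine ⟨_, hpos v (by rintro rfl; simp at hv), fun u => ?_⟩
    rcases eq_or_ne u 0 with rfl | hu
    · simp
    · have hn : ‖u‖ ≠ 0 := norm_ne_zero_iff.2 hu
      have h := hmin (show ‖u‖⁻¹ • u ∈ Metric.sphere (0 : Config D) 1 by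
        rw [mem_sphere_zero_iff_norm, norm_smul, norm_inv, norm_norm, inv_mul_cancel₀ hn])
      simp only [Set.mem_ofPred_eq, WithLp.ofLp_smul, Matrix.mulVec_smul, smul_dotProduct,
        dotProduct_smul, smul_eq_mul] at h
      calc _ ≤ (‖u‖⁻¹ * (‖u‖⁻¹ * (u.ofLp ⬝ᵥ Γ *ᵥ u.ofLp))) * ‖u‖ ^ 2 := by gcongr
        _ = _ := by field_simp
  -- An empty sphere means that every vector is zero, the case `D = 0`.
  · refine ⟨1, one_pos, fun u => ?_⟩
    rcases eq_or_ne u 0 with rfl | hu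
    · simp
    · refine absurd ⟨‖u‖⁻¹ • u, ?_⟩ hne
      rw [mem_sphere_zero_iff_norm, norm_smul, norm_inv, norm_norm,
        inv_mul_cancel₀ (norm_ne_zero_iff.2 hu)]

lemma norm_gaussian (z : Phase D) (x : Config D) :
    ‖gaussian ε Γ z x‖ = |(Γ.det / (Real.pi ^ D * ε ^ D)) ^ (1 / 4 : ℝ)| *
      Real.exp (-(1 / (2 * ε)) * ((x - z.1).ofLp ⬝ᵥ (Γ *ᵥ (x - z.1).ofLp))) := by
  have h : (Complex.I / (ε : ℂ)) * ((inner ℝ z.2 (x - z.1) : ℝ) : ℂ)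
      = (((inner ℝ z.2 (x - z.1) / ε : ℝ)) : ℂ) * Complex.I := by
    push_cast
    ring
  rw [gaussian, norm_mul, Complex.norm_real, Real.norm_eq_abs, Complex.norm_exp, h, Complex.add_re,
    Complex.ofReal_re, Complex.re_ofReal_mul, Complex.I_re, mul_zero, add_zero]

/-- Gaussians decay faster than every power, uniformly with respect to their centre. -/
lemma exists_pow_mul_norm_gaussian_le (hε : 0 < ε) (hΓ : Γ.PosDef) (n : ℕ) :
    ∃ C : ℝ, 0 ≤ C ∧ ∀ z x, (1 + ‖x - z.1‖) ^ n * ‖gaussian ε Γ z x‖ ≤ C := by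
  obtain ⟨a, ha, hQ⟩ := exists_mul_norm_sq_le hΓ
  obtain ⟨C, hC, h⟩ := one_add_pow_mul_exp_neg_le n (a := 1 / (2 * ε) * a) (by positivity)
  refine ⟨|(Γ.det / (Real.pi ^ D * ε ^ D)) ^ (1 / 4 : ℝ)| * C, by positivity, fun z x => ?_⟩
  rw [norm_gaussian, mul_left_comm]
  refine mul_le_mul_of_nonneg_left ((mul_le_mul_of_nonneg_left ?_ (by positivity)).trans
    (h ‖x - z.1‖ (norm_nonneg _))) (abs_nonneg _)
  refine Real.exp_le_exp.2 ?_
  rw [neg_mul, neg_le_neg_iff, mul_assoc]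
  exact mul_le_mul_of_nonneg_left (hQ _) (by positivity)

lemma exists_norm_gaussian_le (hε : 0 < ε) (hΓ : Γ.PosDef) :
    ∃ C : ℝ, 0 ≤ C ∧ ∀ z x, ‖gaussian ε Γ z x‖ ≤ C := by
  simpa using exists_pow_mul_norm_gaussian_le hε hΓ 0

/-- Weighted Gaussians are dominated by an integrable function of the distance to the centre. -/
lemma exists_pow_mul_norm_gaussian_le_inv (hε : 0 < ε) (hΓ : Γ.PosDef) (n k : ℕ) :
    ∃ C : ℝ, 0 ≤ C ∧ ∀ z x,
      (1 + ‖x - z.1‖) ^ n * ‖gaussian ε Γ z x‖ ≤ C * ((1 + ‖x - z.1‖) ^ k)⁻¹ := by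
  obtain ⟨C, hC, h⟩ := exists_pow_mul_norm_gaussian_le hε hΓ (n + k)
  refine ⟨C, hC, fun z x => ?_⟩
  rw [← div_eq_mul_inv, le_div_iff₀ (by positivity)]
  calc _ = (1 + ‖x - z.1‖) ^ (n + k) * ‖gaussian ε Γ z x‖ := by rw [pow_add]; ring
    _ ≤ C := h z x

lemma continuous_uncurry_gaussian : Continuous (Function.uncurry (gaussian ε Γ)) := by
  have h : Continuous fun p : Phase D × Config D =>
      (p.2 - p.1.1).ofLp ⬝ᵥ (Γ *ᵥ (p.2 - p.1.1).ofLp) :=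
    continuous_quadraticForm.comp (by fun_prop)
  change Continuous fun p : Phase D × Config D => gaussian ε Γ p.1 p.2
  unfold gaussian
  fun_prop

/-! ### Derivatives of the Gaussians -/

/-- The symbol `p_j + i (Γ(x - q))_j` by which the momentum operator acts on Gaussians. -/
def momentumSymbol (Γ : Matrix (Fin D) (Fin D) ℝ) (j : Fin D) (z : Phase D) (x : Config D) : ℂ :=
  (z.2 j : ℂ) + Complex.I * (((Γ *ᵥ (x - z.1).ofLp) j : ℝ) : ℂ)

lemma hasFDerivAt_mulVec_apply (j : Fin D) (q x : Config D) :
    HasFDerivAt (fun x : Config D => (Γ *ᵥ (x - q).ofLp) j)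
      (EuclideanSpace.proj j ∘L (Matrix.toEuclideanCLM (𝕜 := ℝ) Γ)) x :=
  (EuclideanSpace.proj j ∘L (Matrix.toEuclideanCLM (𝕜 := ℝ) Γ)).hasFDerivAt.comp x
    ((hasFDerivAt_id x).sub_const q)

lemma hasFDerivAt_quadraticForm (q x : Config D) :
    HasFDerivAt (fun x : Config D => (x - q).ofLp ⬝ᵥ (Γ *ᵥ (x - q).ofLp))
      (∑ i, ((x - q) i • (EuclideanSpace.proj i ∘L (Matrix.toEuclideanCLM (𝕜 := ℝ) Γ)) +
        (Γ *ᵥ (x - q).ofLp) i • EuclideanSpace.proj i)) x := by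
  simp only [dotProduct]
  refine HasFDerivAt.fun_sum fun i _ => ?_
  exact ((EuclideanSpace.proj (𝕜 := ℝ) i).hasFDerivAt.comp x
    ((hasFDerivAt_id x).sub_const q)).mul (hasFDerivAt_mulVec_apply i q x)

lemma partialD_momentumSymbol (j : Fin D) (z : Phase D) (x : Config D) :
    DifferentiableAt ℝ (momentumSymbol Γ j z) x ∧
      partialD j (momentumSymbol Γ j z) x = Complex.I * Γ j j := by
  have h := ((Complex.ofRealCLM.hasFDerivAt.comp x
    (hasFDerivAt_mulVec_apply (Γ := Γ) j z.1 x)).const_mul Complex.I).const_add (z.2 j : ℂ)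
  refine ⟨h.differentiableAt, ?_⟩
  refine (congrArg (fun L => L (EuclideanSpace.single j 1)) h.fderiv).trans ?_
  simp [Matrix.ofLp_toEuclideanCLM]

lemma partialD_gaussian (hΓ : Γ.PosDef) (j : Fin D) (z : Phase D) (x : Config D) :
    DifferentiableAt ℝ (gaussian ε Γ z) x ∧ partialD j (gaussian ε Γ z) x
      = Complex.I / ε * momentumSymbol Γ j z x * gaussian ε Γ z x := by
  have h1 := Complex.ofRealCLM.hasFDerivAt.comp x
    ((hasFDerivAt_quadraticForm (Γ := Γ) z.1 x).const_mul (-(1 / (2 * ε))))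
  have h2 := (Complex.ofRealCLM.hasFDerivAt.comp x (((innerSL ℝ z.2).hasFDerivAt).comp x
    ((hasFDerivAt_id x).sub_const z.1))).const_mul (Complex.I / (ε : ℂ))
  have h := ((h1.add h2).cexp).const_mul
    ((((Γ.det / (Real.pi ^ D * ε ^ D)) ^ (1 / 4 : ℝ) : ℝ) : ℂ))
  refine ⟨h.differentiableAt, ?_⟩
  -- Symmetry of `Γ` merges the two terms of the product rule into `2Γ(x - q)`.
  have hsymm : ∑ i, (x - z.1) i * Γ i j = (Γ *ᵥ (x - z.1).ofLp) j := by
    simp only [Matrix.mulVec, dotProduct]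
    refine Finset.sum_congr rfl fun i _ => ?_
    have : Γ i j = Γ j i := by
      have := congrFun (congrFun hΓ.isHermitian j) i
      simpa using this
    rw [this, mul_comm]
  have hA : (∑ i, ((x - z.1) i • (EuclideanSpace.proj i ∘L (Matrix.toEuclideanCLM (𝕜 := ℝ) Γ)) +
      (Γ *ᵥ (x - z.1).ofLp) i • EuclideanSpace.proj (𝕜 := ℝ) i)) (EuclideanSpace.single j 1)
      = 2 * (Γ *ᵥ (x - z.1).ofLp) j := by
    rw [two_mul]
    nth_rewrite 1 [← hsymm]
    simp only [sum_apply, add_apply, smul_apply,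
      ContinuousLinearMap.comp_apply, PiLp.proj_apply, Matrix.ofLp_toEuclideanCLM,
      smul_eq_mul, Finset.sum_add_distrib]
    simp
  have hB : inner ℝ z.2 (EuclideanSpace.single j 1) = z.2 j := by
    simp [EuclideanSpace.inner_single_right]
  have hC : partialD j (gaussian ε Γ z) x = gaussian ε Γ z x *
      (((-(1 / (2 * ε)) * ((∑ i, ((x - z.1) i •
        (EuclideanSpace.proj i ∘L (Matrix.toEuclideanCLM (𝕜 := ℝ) Γ)) +
        (Γ *ᵥ (x - z.1).ofLp) i • EuclideanSpace.proj (𝕜 := ℝ) i)) (EuclideanSpace.single j 1)) : ℝ)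
        : ℂ) + Complex.I / (ε : ℂ) * ((inner ℝ z.2 (EuclideanSpace.single j 1) : ℝ) : ℂ)) :=
    (congrArg (fun L => L (EuclideanSpace.single j 1)) h.fderiv).trans (mul_assoc _ _ _).symm
  rw [hC, hA, hB, momentumSymbol]
  push_cast
  linear_combination (-(1 / ε : ℂ) * ((Γ *ᵥ (x - z.1).ofLp) j : ℝ) * gaussian ε Γ z x) *
    Complex.I_mul_I

end HermanKluk

end

/-! ### Symbols of the observables, and decay of the phase space transform. -/

noncomputable section

namespace HermanKluk

open scoped Matrix

variable {D : ℕ} {ε : ℝ} {Γ : Matrix (Fin D) (Fin D) ℝ} {V : Config D → ℝ}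

/-! ### Polynomially bounded symbols -/

/-- The polynomial weight `(1 + |x - q|) (1 + |z|)` at a point `(z, x)`, `z = (q, p)`. -/
def weight (a : Phase D × Config D) : ℝ := (1 + ‖a.2 - a.1.1‖) * (1 + ‖a.1‖)

lemma one_le_weight (a : Phase D × Config D) : 1 ≤ weight a := by
  unfold weight
  nlinarith [norm_nonneg (a.2 - a.1.1), norm_nonneg a.1,
    mul_nonneg (norm_nonneg (a.2 - a.1.1)) (norm_nonneg a.1)]

lemma one_add_norm_le_weight (a : Phase D × Config D) : 1 + ‖a.2‖ ≤ weight a := by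
  have h1 : ‖a.2‖ ≤ ‖a.2 - a.1.1‖ + ‖a.1‖ := by
    calc ‖a.2‖ = ‖(a.2 - a.1.1) + a.1.1‖ := by rw [sub_add_cancel]
      _ ≤ ‖a.2 - a.1.1‖ + ‖a.1.1‖ := norm_add_le _ _
      _ ≤ _ := by gcongr; exact norm_fst_le a.1
  unfold weight
  nlinarith [mul_nonneg (norm_nonneg (a.2 - a.1.1)) (norm_nonneg a.1)]

/-- Continuous functions of `(z, x)` bounded by a power of the weight. -/
def IsSymbol (s : Phase D × Config D → ℂ) : Prop :=
  Continuous s ∧ ∃ (C : ℝ) (m : ℕ), 0 ≤ C ∧ ∀ a, ‖s a‖ ≤ C * weight a ^ m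

namespace IsSymbol

variable {s s' : Phase D × Config D → ℂ}

lemma const (c : ℂ) : IsSymbol fun _ : Phase D × Config D => c :=
  ⟨continuous_const, ‖c‖, 0, norm_nonneg c, fun a => by simp⟩

lemma add (hs : IsSymbol s) (hs' : IsSymbol s') : IsSymbol fun a => s a + s' a := by
  obtain ⟨hc, C, m, hC, h⟩ := hs
  obtain ⟨hc', C', m', hC', h'⟩ := hs'
  refine ⟨hc.add hc', C + C', m + m', by positivity, fun a => ?_⟩
  have h1 : weight a ^ m ≤ weight a ^ (m + m') :=
    pow_le_pow_right₀ (one_le_weight a) (Nat.le_add_right _ _)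
  have h2 : weight a ^ m' ≤ weight a ^ (m + m') :=
    pow_le_pow_right₀ (one_le_weight a) (Nat.le_add_left _ _)
  calc ‖s a + s' a‖ ≤ C * weight a ^ m + C' * weight a ^ m' :=
        (norm_add_le _ _).trans (add_le_add (h a) (h' a))
    _ ≤ C * weight a ^ (m + m') + C' * weight a ^ (m + m') := by gcongr
    _ = _ := by ring

lemma mul (hs : IsSymbol s) (hs' : IsSymbol s') : IsSymbol fun a => s a * s' a := by
  obtain ⟨hc, C, m, hC, h⟩ := hs
  obtain ⟨hc', C', m', hC', h'⟩ := hs'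
  refine ⟨hc.mul hc', C * C', m + m', by positivity, fun a => ?_⟩
  have hw : 0 ≤ weight a := zero_le_one.trans (one_le_weight a)
  calc ‖s a * s' a‖ ≤ (C * weight a ^ m) * (C' * weight a ^ m') := by
        rw [norm_mul]
        exact mul_le_mul (h a) (h' a) (norm_nonneg _) (by positivity)
    _ = _ := by ring

lemma pow (hs : IsSymbol s) (n : ℕ) : IsSymbol fun a => s a ^ n := by
  induction n with
  | zero => simpa using const 1
  | succ n ih => simpa only [pow_succ] using ih.mul hs

lemma sum {ι : Type*} (t : Finset ι) {s : ι → Phase D × Config D → ℂ}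
    (hs : ∀ i, IsSymbol (s i)) : IsSymbol fun a => ∑ i ∈ t, s i a := by
  classical
  induction t using Finset.induction_on with
  | empty => simpa using const 0
  | insert i t hi ih =>
    simp only [Finset.sum_insert hi]
    exact (hs i).add ih

lemma polynomial (hs : IsSymbol s) (H : Polynomial ℂ) : IsSymbol fun a => H.eval (s a) := by
  simp only [Polynomial.eval_eq_sum_range]
  exact sum _ fun i => (const _).mul (hs.pow i)

end IsSymbol

lemma isSymbol_momentumSymbol (j : Fin D) :
    IsSymbol fun a : Phase D × Config D => momentumSymbol Γ j a.1 a.2 := by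
  refine ⟨?_, 1 + ‖Matrix.toEuclideanCLM (𝕜 := ℝ) Γ‖, 1, by positivity, fun a => ?_⟩
  · simp only [momentumSymbol, Matrix.mulVec, dotProduct]
    fun_prop
  · have h1 : ‖(a.1.2 j : ℂ)‖ ≤ ‖a.1‖ := by
      rw [Complex.norm_real]
      exact (PiLp.norm_apply_le a.1.2 j).trans (norm_snd_le a.1)
    have h2 : ‖(((Γ *ᵥ (a.2 - a.1.1).ofLp) j : ℝ) : ℂ)‖
        ≤ ‖Matrix.toEuclideanCLM (𝕜 := ℝ) Γ‖ * ‖a.2 - a.1.1‖ := by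
      rw [Complex.norm_real]
      exact (PiLp.norm_apply_le (Matrix.toEuclideanCLM (𝕜 := ℝ) Γ (a.2 - a.1.1)) j).trans
        (ContinuousLinearMap.le_opNorm _ _)
    have h3 : ‖momentumSymbol Γ j a.1 a.2‖
        ≤ ‖a.1‖ + ‖Matrix.toEuclideanCLM (𝕜 := ℝ) Γ‖ * ‖a.2 - a.1.1‖ := by
      refine (norm_add_le _ _).trans (add_le_add h1 ?_)
      rwa [norm_mul, Complex.norm_I, one_mul]
    refine h3.trans ?_
    have h4 := norm_nonneg a.1
    have h5 := norm_nonneg (a.2 - a.1.1)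
    have h6 := norm_nonneg (Matrix.toEuclideanCLM (𝕜 := ℝ) Γ)
    have h7 : ‖a.1‖ ≤ weight a := by
      unfold weight; nlinarith [mul_nonneg h4 h5]
    have h8 : ‖a.2 - a.1.1‖ ≤ weight a := by
      unfold weight; nlinarith [mul_nonneg h4 h5]
    rw [pow_one, add_mul, one_mul]
    gcongr

/-! ### Observables act on Gaussians by symbols -/

/-- The polynomial by which `∂_j (H(a_j) g_z)` is obtained from `g_z`, `a_j` the momentum
symbol. -/
def derivPolynomial (ε : ℝ) (Γ : Matrix (Fin D) (Fin D) ℝ) (j : Fin D) (H : Polynomial ℂ) :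
    Polynomial ℂ :=
  Polynomial.C (Complex.I / ε) * Polynomial.X * H
    + Polynomial.C (Complex.I * Γ j j) * Polynomial.derivative H

/-- As `∂_j a_j = iΓ_jj` is constant and `∂_j g_z = (i/ε) a_j g_z`, polynomials in `a_j` times `g_z`
are closed under `∂_j`, and the new polynomial does not depend on `z`. -/
lemma partialD_polynomial_mul_gaussian (hΓ : Γ.PosDef) (H : Polynomial ℂ) (j : Fin D)
    (z : Phase D) (x : Config D) :
    DifferentiableAt ℝ (fun x => H.eval (momentumSymbol Γ j z x) * gaussian ε Γ z x) x ∧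
    partialD j (fun x => H.eval (momentumSymbol Γ j z x) * gaussian ε Γ z x) x
      = (derivPolynomial ε Γ j H).eval (momentumSymbol Γ j z x) * gaussian ε Γ z x := by
  obtain ⟨ha, ha'⟩ := partialD_momentumSymbol (Γ := Γ) j z x
  obtain ⟨hg, hg'⟩ := partialD_gaussian (ε := ε) hΓ j z x
  have h := ((H.hasDerivAt (momentumSymbol Γ j z x)).comp_hasFDerivAt x ha.hasFDerivAt).mul
    hg.hasFDerivAt
  refine ⟨h.differentiableAt, ?_⟩
  have h2 := congrArg (fun L => L (EuclideanSpace.single j 1)) h.fderiv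
  unfold partialD at ha' hg' ⊢
  refine h2.trans ?_
  simp only [add_apply, smul_apply, smul_eq_mul, ha', hg', derivPolynomial, Polynomial.eval_add,
    Polynomial.eval_mul, Polynomial.eval_C, Polynomial.eval_X, Function.comp_apply]
  ring

lemma exists_momentumOp_iterate_gaussian (hΓ : Γ.PosDef) (j : Fin D) (n : ℕ) :
    ∃ H : Polynomial ℂ, ∀ z : Phase D, (momentumOp ε j)^[n] (gaussian ε Γ z)
      = fun x => H.eval (momentumSymbol Γ j z x) * gaussian ε Γ z x := by
  induction n with
  | zero => exact ⟨1, fun z => by simp⟩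
  | succ n ih =>
    obtain ⟨H, hH⟩ := ih
    refine ⟨Polynomial.C (-Complex.I * ε) * derivPolynomial ε Γ j H, fun z => ?_⟩
    funext x
    rw [Function.iterate_succ_apply', hH z, momentumOp,
      (partialD_polynomial_mul_gaussian hΓ H j z x).2]
    simp only [Polynomial.eval_mul, Polynomial.eval_C]
    ring

/-- Every observable acts on Gaussians as the multiplication by a symbol. -/
lemma exists_isSymbol_apply_gaussian (hΓ : Γ.PosDef) (hV : IsSubquadratic V) (A : Observable D) :
    ∃ s : Phase D × Config D → ℂ, IsSymbol s ∧ ∀ z x,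
      A.apply ε V (gaussian ε Γ z) x = s (z, x) * gaussian ε Γ z x := by
  cases A with
  | id => exact ⟨fun _ => 1, IsSymbol.const 1, fun z x => (one_mul _).symm⟩
  | position j n =>
    refine ⟨fun a => ((a.2 j : ℝ) : ℂ) ^ n, IsSymbol.pow ⟨by fun_prop, 1, 1, zero_le_one,
      fun a => ?_⟩ n, fun z x => rfl⟩
    rw [Complex.norm_real, one_mul, pow_one]
    linarith [PiLp.norm_apply_le a.2 j, one_add_norm_le_weight a]
  | momentum j n =>
    obtain ⟨H, hH⟩ := exists_momentumOp_iterate_gaussian (ε := ε) hΓ j n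
    exact ⟨_, (isSymbol_momentumSymbol j).polynomial H, fun z x => congrFun (hH z) x⟩
  | hamiltonian =>
    have hVs : IsSymbol fun a : Phase D × Config D => (V a.2 : ℂ) := by
      obtain ⟨C, hC, h⟩ := hV.exists_abs_le
      have hVc := hV.1.continuous
      refine ⟨by fun_prop, C, 2, hC, fun a => ?_⟩
      rw [Complex.norm_real, Real.norm_eq_abs]
      refine (h a.2).trans ?_
      gcongr
      exact one_add_norm_le_weight a
    have hs : ∀ j : Fin D, IsSymbol fun a : Phase D × Config D =>
        (derivPolynomial ε Γ j (derivPolynomial ε Γ j 1)).eval (momentumSymbol Γ j a.1 a.2) :=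
      fun j => (isSymbol_momentumSymbol j).polynomial _
    refine ⟨_, ((IsSymbol.const (-((ε : ℂ) ^ 2 / 2))).mul
      (IsSymbol.sum Finset.univ hs)).add hVs, fun z x => ?_⟩
    have hd : ∀ j, partialD j (partialD j (gaussian ε Γ z)) x =
        (derivPolynomial ε Γ j (derivPolynomial ε Γ j 1)).eval (momentumSymbol Γ j z x)
          * gaussian ε Γ z x := fun j => by
      have h1 : partialD j (gaussian ε Γ z) = fun x =>
          (derivPolynomial ε Γ j 1).eval (momentumSymbol Γ j z x) * gaussian ε Γ z x := by
        funext x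
        rw [← (partialD_polynomial_mul_gaussian hΓ 1 j z x).2]
        simp
      rw [h1, (partialD_polynomial_mul_gaussian hΓ _ j z x).2]
    simp only [Observable.apply, hd, ← Finset.sum_mul]
    ring

/-! ### Matrix elements of the observables between Gaussians -/

/-- The weight factorises: `g_z` absorbs the power of `1 + |x - q|` and still decays integrably,
leaving the power of `1 + |z|`. For `g_y` a bound uniform in `y` is enough. -/
lemma exists_norm_l2inner_apply_gaussian_le (hε : 0 < ε) (hΓ : Γ.PosDef) (hV : IsSubquadratic V)
    (A : Observable D) : ∃ (C : ℝ) (m : ℕ), 0 ≤ C ∧ ∀ y z : Phase D,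
      ‖l2inner (gaussian ε Γ y) (A.apply ε V (gaussian ε Γ z))‖ ≤ C * (1 + ‖z‖) ^ m := by
  obtain ⟨s, ⟨-, C, m, hC, hs⟩, hA⟩ := exists_isSymbol_apply_gaussian (ε := ε) hΓ hV A
  obtain ⟨G, hG, hg⟩ := exists_norm_gaussian_le hε hΓ
  obtain ⟨K, hK, hk⟩ := exists_pow_mul_norm_gaussian_le_inv hε hΓ m (D + 1)
  have hint : Integrable fun x : Config D => ((1 + ‖x‖) ^ (D + 1))⁻¹ :=
    integrable_inv_one_add_norm_pow (by simp)
  refine ⟨G * C * K * ∫ x : Config D, ((1 + ‖x‖) ^ (D + 1))⁻¹, m, ?_, fun y z => ?_⟩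
  · have : 0 ≤ ∫ x : Config D, ((1 + ‖x‖) ^ (D + 1))⁻¹ := integral_nonneg fun x => by positivity
    positivity
  · have hb : ∀ x, ‖conj (gaussian ε Γ y x) * A.apply ε V (gaussian ε Γ z) x‖
        ≤ G * C * K * (1 + ‖z‖) ^ m * ((1 + ‖x - z.1‖) ^ (D + 1))⁻¹ := by
      intro x
      rw [hA, norm_mul, norm_mul, RCLike.norm_conj]
      calc ‖gaussian ε Γ y x‖ * (‖s (z, x)‖ * ‖gaussian ε Γ z x‖)
          ≤ G * (C * weight (z, x) ^ m * ‖gaussian ε Γ z x‖) :=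
            mul_le_mul (hg y x) (mul_le_mul_of_nonneg_right (hs _) (norm_nonneg _))
              (by positivity) hG
        _ = G * C * (1 + ‖z‖) ^ m * ((1 + ‖x - z.1‖) ^ m * ‖gaussian ε Γ z x‖) := by
            rw [weight, mul_pow]
            ring
        _ ≤ G * C * (1 + ‖z‖) ^ m * (K * ((1 + ‖x - z.1‖) ^ (D + 1))⁻¹) :=
            mul_le_mul_of_nonneg_left (hk z x) (by positivity)
        _ = _ := by ring
    refine (norm_integral_le_of_norm_le ((hint.comp_sub_right z.1).const_mul _)
      (ae_of_all _ hb)).trans (le_of_eq ?_)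
    rw [integral_const_mul, integral_sub_right_eq_self (fun x : Config D => ((1 + ‖x‖) ^ (D + 1))⁻¹)]
    ring

lemma measurable_l2inner_apply_gaussian (hΓ : Γ.PosDef) (hV : IsSubquadratic V)
    (A : Observable D) : Measurable fun w : Phase D × Phase D =>
      l2inner (gaussian ε Γ w.1) (A.apply ε V (gaussian ε Γ w.2)) := by
  obtain ⟨s, ⟨hs, -⟩, hA⟩ := exists_isSymbol_apply_gaussian (ε := ε) hΓ hV A
  have hg := continuous_uncurry_gaussian (ε := ε) (Γ := Γ)
  have h : Continuous fun p : (Phase D × Phase D) × Config D =>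
      conj (Function.uncurry (gaussian ε Γ) (p.1.1, p.2)) *
        (s (p.1.2, p.2) * Function.uncurry (gaussian ε Γ) (p.1.2, p.2)) := by
    have := Complex.continuous_conj
    fun_prop
  simp only [l2inner, hA]
  exact h.stronglyMeasurable.integral_prod_right.measurable

lemma measurable_l2inner_gaussian {ψ : Config D → ℂ} (hψ : Continuous ψ) :
    Measurable fun z : Phase D => l2inner (gaussian ε Γ z) ψ := by
  have hg := continuous_uncurry_gaussian (ε := ε) (Γ := Γ)
  have h : Continuous fun p : Phase D × Config D =>
      conj (Function.uncurry (gaussian ε Γ) p) * ψ p.2 := by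
    have := Complex.continuous_conj
    fun_prop
  exact h.stronglyMeasurable.integral_prod_right.measurable

lemma l2inner_conj_symm (φ ψ : Config D → ℂ) : conj (l2inner φ ψ) = l2inner ψ φ := by
  rw [l2inner, l2inner, ← integral_conj]
  simp [mul_comm]

/-! ### Decay of the phase space transform of Schwartz functions -/

/-- The symbol `p_j + i (Γq)_j` of the creation-type operator. -/
def bargmannSymbol (Γ : Matrix (Fin D) (Fin D) ℝ) (j : Fin D) (z : Phase D) : ℂ :=
  (z.2 j : ℂ) + Complex.I * (((Γ *ᵥ z.1.ofLp) j : ℝ) : ℂ)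

/-- The real parts of the symbols are the components of `p`, the imaginary parts those of `Γq`, and
`Γ` is invertible. -/
lemma exists_one_add_norm_le_bargmannSymbol (hΓ : Γ.PosDef) :
    ∃ K : ℝ, 0 ≤ K ∧ ∀ z : Phase D, 1 + ‖z‖ ≤ K * (1 + ∑ j, ‖bargmannSymbol Γ j z‖) := by
  have hsum : ∀ u : Config D, ‖u‖ ≤ ∑ j, |u j| := fun u => by
    calc ‖u‖ = ‖∑ j, (EuclideanSpace.basisFun (Fin D) ℝ).repr u j •
          EuclideanSpace.basisFun (Fin D) ℝ j‖ := by rw [OrthonormalBasis.sum_repr]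
      _ ≤ _ := (norm_sum_le _ _).trans (le_of_eq (by simp [norm_smul]))
  refine ⟨1 + ‖Matrix.toEuclideanCLM (𝕜 := ℝ) Γ⁻¹‖, by positivity, fun z => ?_⟩
  have hp : ‖z.2‖ ≤ ∑ j, ‖bargmannSymbol Γ j z‖ :=
    (hsum z.2).trans (Finset.sum_le_sum fun j _ => by
      simpa [bargmannSymbol] using Complex.abs_re_le_norm (bargmannSymbol Γ j z))
  have hq : ‖z.1‖ ≤ ‖Matrix.toEuclideanCLM (𝕜 := ℝ) Γ⁻¹‖ * ∑ j, ‖bargmannSymbol Γ j z‖ := by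
    have h1 : Matrix.toEuclideanCLM (𝕜 := ℝ) Γ⁻¹ (Matrix.toEuclideanCLM (𝕜 := ℝ) Γ z.1) = z.1 := by
      rw [← mul_apply_eq_comp, ← map_mul,
        Matrix.nonsing_inv_mul _ ((Matrix.isUnit_iff_isUnit_det _).1 hΓ.isUnit), map_one]
      rfl
    have h2 : ‖Matrix.toEuclideanCLM (𝕜 := ℝ) Γ z.1‖ ≤ ∑ j, ‖bargmannSymbol Γ j z‖ :=
      (hsum _).trans (Finset.sum_le_sum fun j _ => by
        simpa [bargmannSymbol, Matrix.ofLp_toEuclideanCLM] using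
          Complex.abs_im_le_norm (bargmannSymbol Γ j z))
    calc ‖z.1‖ = ‖Matrix.toEuclideanCLM (𝕜 := ℝ) Γ⁻¹ (Matrix.toEuclideanCLM (𝕜 := ℝ) Γ z.1)‖ := by
          rw [h1]
      _ ≤ _ := (ContinuousLinearMap.le_opNorm _ _).trans (by gcongr)
  have hS : 0 ≤ ∑ j, ‖bargmannSymbol Γ j z‖ := Finset.sum_nonneg fun _ _ => norm_nonneg _
  have hT := norm_nonneg (Matrix.toEuclideanCLM (𝕜 := ℝ) Γ⁻¹)
  have hz : ‖z‖ ≤ (1 + ‖Matrix.toEuclideanCLM (𝕜 := ℝ) Γ⁻¹‖) * ∑ j, ‖bargmannSymbol Γ j z‖ := by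
    rw [Prod.norm_def]
    refine max_le (hq.trans ?_) (hp.trans ?_) <;> nlinarith
  linarith

lemma fderiv_conj_gaussian (hΓ : Γ.PosDef) (j : Fin D) (z : Phase D) (x : Config D) :
    DifferentiableAt ℝ (fun x => conj (gaussian ε Γ z x)) x ∧
    fderiv ℝ (fun x => conj (gaussian ε Γ z x)) x (EuclideanSpace.single j 1)
      = -(Complex.I / ε) * (conj (momentumSymbol Γ j z x) * conj (gaussian ε Γ z x)) := by
  have hd : HasFDerivAt (fun x => conj (gaussian ε Γ z x))
      (Complex.conjCLE.toContinuousLinearMap ∘L fderiv ℝ (gaussian ε Γ z) x) x :=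
    Complex.conjCLE.toContinuousLinearMap.hasFDerivAt.comp x
      (partialD_gaussian hΓ j z x).1.hasFDerivAt
  refine ⟨hd.differentiableAt, ?_⟩
  rw [hd.fderiv]
  change conj (partialD j (gaussian ε Γ z) x) = _
  rw [(partialD_gaussian hΓ j z x).2]
  simp only [map_mul, map_div₀, Complex.conj_I, Complex.conj_ofReal]
  ring

lemma continuous_gaussian (z : Phase D) : Continuous (gaussian ε Γ z) := by
  have h : Continuous fun x : Config D => (z, x) := by fun_prop
  have h2 := (continuous_uncurry_gaussian (ε := ε) (Γ := Γ)).comp h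
  exact h2

lemma integrable_conj_gaussian_mul (hε : 0 < ε) (hΓ : Γ.PosDef) (z : Phase D)
    (φ : 𝓢(Config D, ℂ)) : Integrable fun x => conj (gaussian ε Γ z x) * φ x := by
  obtain ⟨C, -, hg⟩ := exists_norm_gaussian_le hε hΓ
  exact φ.integrable.bdd_mul (c := C)
    (Complex.continuous_conj.comp (continuous_gaussian z)).aestronglyMeasurable
    (ae_of_all _ fun x => by rw [RCLike.norm_conj]; exact hg z x)

lemma integrable_conj_momentumSymbol_mul (hε : 0 < ε) (hΓ : Γ.PosDef) (j : Fin D) (z : Phase D)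
    (ψ : 𝓢(Config D, ℂ)) : Integrable fun x =>
      (conj (momentumSymbol Γ j z x) * conj (gaussian ε Γ z x)) * ψ x := by
  obtain ⟨hac, B, m, hB, hb⟩ := isSymbol_momentumSymbol (Γ := Γ) j
  obtain ⟨K, hK, hk⟩ := exists_pow_mul_norm_gaussian_le hε hΓ m
  have hac' : Continuous (momentumSymbol Γ j z) :=
    hac.comp (continuous_const.prodMk continuous_id)
  refine ψ.integrable.bdd_mul (c := B * (1 + ‖z‖) ^ m * K)
    ((Complex.continuous_conj.comp hac').mul
      (Complex.continuous_conj.comp (continuous_gaussian z))).aestronglyMeasurable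
    (ae_of_all _ fun x => ?_)
  rw [norm_mul, RCLike.norm_conj, RCLike.norm_conj]
  calc ‖momentumSymbol Γ j z x‖ * ‖gaussian ε Γ z x‖
      ≤ B * weight (z, x) ^ m * ‖gaussian ε Γ z x‖ :=
        mul_le_mul_of_nonneg_right (hb (z, x)) (norm_nonneg _)
    _ = B * (1 + ‖z‖) ^ m * ((1 + ‖x - z.1‖) ^ m * ‖gaussian ε Γ z x‖) := by
        rw [weight, mul_pow]
        ring
    _ ≤ _ := mul_le_mul_of_nonneg_left (hk z x) (by positivity)

lemma integral_conj_gaussian_mul_lineDeriv (hε : 0 < ε) (hΓ : Γ.PosDef) (j : Fin D) (z : Phase D)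
    (ψ : 𝓢(Config D, ℂ)) :
    ∫ x, conj (gaussian ε Γ z x) * fderiv ℝ ψ x (EuclideanSpace.single j 1) = Complex.I / ε *
      ∫ x, (conj (momentumSymbol Γ j z x) * conj (gaussian ε Γ z x)) * ψ x := by
  have hde := fun x => (fderiv_conj_gaussian (ε := ε) hΓ j z x).2
  have h := integral_mul_fderiv_eq_neg_fderiv_mul_of_integrable (μ := volume)
    (v := EuclideanSpace.single j 1) (f := fun x => conj (gaussian ε Γ z x)) (g := ψ)
    (by simpa only [hde, mul_assoc] using
      (integrable_conj_momentumSymbol_mul hε hΓ j z ψ).const_mul (-(Complex.I / ε)))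
    (integrable_conj_gaussian_mul hε hΓ z (LineDeriv.lineDerivOp (EuclideanSpace.single j (1 : ℝ)) ψ))
    (integrable_conj_gaussian_mul hε hΓ z ψ)
    (fun x _ => (fderiv_conj_gaussian hΓ j z x).1) (fun x _ => ψ.differentiableAt)
  refine h.trans ?_
  simp only [hde]
  rw [← integral_const_mul, ← integral_neg]
  congr 1
  funext x
  ring

/-- Multiplication of the transform by the Bargmann symbol corresponds to an operator on Schwartz
functions. -/
lemma exists_bargmannSymbol_mul_l2inner (hε : 0 < ε) (hΓ : Γ.PosDef) (j : Fin D)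
    (ψ : 𝓢(Config D, ℂ)) : ∃ φ : 𝓢(Config D, ℂ), ∀ z : Phase D,
      bargmannSymbol Γ j z * l2inner (gaussian ε Γ z) ψ = l2inner (gaussian ε Γ z) φ := by
  have hε' : (ε : ℂ) ≠ 0 := by exact_mod_cast hε.ne'
  obtain ⟨Lψ, hLψ⟩ : ∃ φ : 𝓢(Config D, ℂ), ∀ x, φ x = (((Γ *ᵥ x.ofLp) j : ℝ) : ℂ) * ψ x :=
    ⟨SchwartzMap.smulLeftCLM ℂ (fun x => (Complex.ofRealCLM ∘L EuclideanSpace.proj j ∘L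
      (Matrix.toEuclideanCLM (𝕜 := ℝ) Γ)) x) ψ, fun x => congrFun
        (SchwartzMap.smulLeftCLM_apply (ContinuousLinearMap.hasTemperateGrowth _) ψ) x⟩
  obtain ⟨dψ, hdψ⟩ : ∃ φ : 𝓢(Config D, ℂ),
      ∀ x, φ x = fderiv ℝ ψ x (EuclideanSpace.single j 1) :=
    ⟨LineDeriv.lineDerivOp (EuclideanSpace.single j (1 : ℝ)) ψ, fun x => rfl⟩
  -- Moving `p̂_j` from `ψ` onto `g_z` gives the factor `conj a_j`, which is the Bargmann symbol
  -- minus `i(Γx)_j`; adding `i(Γx)_j ψ` cancels the dependence on `x`.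
  refine ⟨(-Complex.I * ε) • dψ + Complex.I • Lψ, fun z => ?_⟩
  have hibp := integral_conj_gaussian_mul_lineDeriv hε hΓ j z ψ
  have h1 := integrable_conj_gaussian_mul hε hΓ z dψ
  have h2 := integrable_conj_gaussian_mul hε hΓ z Lψ
  have hsplit : l2inner (gaussian ε Γ z) ((-Complex.I * ε) • dψ + Complex.I • Lψ : 𝓢(Config D, ℂ))
      = (-Complex.I * ε) * (∫ x, conj (gaussian ε Γ z x) * dψ x)
        + Complex.I * ∫ x, conj (gaussian ε Γ z x) * Lψ x := by
    rw [l2inner, ← integral_const_mul, ← integral_const_mul,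
      ← integral_add (h1.const_mul _) (h2.const_mul _)]
    congr 1
    funext x
    simp only [add_apply, smul_apply, smul_eq_mul]
    ring
  have hfac : -Complex.I * ε * (Complex.I / ε) = 1 := by
    field_simp
    simp
  simp only [← hdψ] at hibp
  rw [hsplit, hibp, ← mul_assoc, hfac, one_mul, l2inner, ← integral_const_mul,
    ← integral_const_mul,
    ← integral_add (integrable_conj_momentumSymbol_mul hε hΓ j z ψ) (h2.const_mul _)]
  congr 1
  funext x
  have hsub : (Γ *ᵥ (x - z.1).ofLp) j = (Γ *ᵥ x.ofLp) j - (Γ *ᵥ z.1.ofLp) j := by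
    rw [WithLp.ofLp_sub, Matrix.mulVec_sub, Pi.sub_apply]
  rw [hLψ, bargmannSymbol, momentumSymbol, hsub]
  simp only [map_add, map_mul, Complex.conj_I, Complex.conj_ofReal]
  push_cast
  ring

lemma norm_l2inner_le_of_norm_le {G : ℝ} {g : Config D → ℂ} (hg : ∀ x, ‖g x‖ ≤ G)
    (ψ : 𝓢(Config D, ℂ)) : ‖l2inner g ψ‖ ≤ G * ∫ x, ‖ψ x‖ := by
  rw [← integral_const_mul]
  refine norm_integral_le_of_norm_le (ψ.integrable.norm.const_mul G) (ae_of_all _ fun x => ?_)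
  rw [norm_mul, RCLike.norm_conj]
  exact mul_le_mul_of_nonneg_right (hg x) (norm_nonneg _)

/-- The phase space transform of a Schwartz function decays faster than every power. -/
lemma exists_pow_mul_norm_l2inner_gaussian_le (hε : 0 < ε) (hΓ : Γ.PosDef) (n : ℕ)
    (ψ : 𝓢(Config D, ℂ)) : ∃ C : ℝ, 0 ≤ C ∧ ∀ z : Phase D,
      (1 + ‖z‖) ^ n * ‖l2inner (gaussian ε Γ z) ψ‖ ≤ C := by
  -- Quantified over all Schwartz functions, since the induction step applies the hypothesis to each
  -- `φ j` as well as to `ψ`.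
  have key : ∀ ψ : 𝓢(Config D, ℂ), ∃ C : ℝ, 0 ≤ C ∧ ∀ z : Phase D,
      (1 + ∑ j, ‖bargmannSymbol Γ j z‖) ^ n * ‖l2inner (gaussian ε Γ z) ψ‖ ≤ C := by
    induction n with
    | zero =>
      intro ψ
      obtain ⟨G, hG, hg⟩ := exists_norm_gaussian_le hε hΓ
      refine ⟨G * ∫ x, ‖ψ x‖, mul_nonneg hG (integral_nonneg fun _ => norm_nonneg _), fun z => ?_⟩
      rw [pow_zero, one_mul]
      exact norm_l2inner_le_of_norm_le (hg z) ψ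
    | succ n ih =>
      intro ψ
      choose φ hφ using fun j => exists_bargmannSymbol_mul_l2inner hε hΓ j ψ
      obtain ⟨C, hC, h⟩ := ih ψ
      choose B hB hb using fun j => ih (φ j)
      refine ⟨C + ∑ j, B j, add_nonneg hC (Finset.sum_nonneg fun j _ => hB j), fun z => ?_⟩
      have e : (1 + ∑ j, ‖bargmannSymbol Γ j z‖) ^ (n + 1) * ‖l2inner (gaussian ε Γ z) ψ‖
          = (1 + ∑ j, ‖bargmannSymbol Γ j z‖) ^ n * ‖l2inner (gaussian ε Γ z) ψ‖
          + ∑ j, (1 + ∑ j, ‖bargmannSymbol Γ j z‖) ^ n * ‖l2inner (gaussian ε Γ z) (φ j)‖ := by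
        simp only [← hφ, norm_mul, ← Finset.mul_sum, ← Finset.sum_mul]
        ring
      rw [e]
      exact add_le_add (h z) (Finset.sum_le_sum fun j _ => hb j z)
  obtain ⟨K, hK, hk⟩ := exists_one_add_norm_le_bargmannSymbol hΓ
  obtain ⟨C, hC, h⟩ := key ψ
  refine ⟨K ^ n * C, by positivity, fun z => ?_⟩
  calc (1 + ‖z‖) ^ n * ‖l2inner (gaussian ε Γ z) ψ‖
      ≤ (K * (1 + ∑ j, ‖bargmannSymbol Γ j z‖)) ^ n * ‖l2inner (gaussian ε Γ z) ψ‖ := by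
        gcongr
        exact hk z
    _ = K ^ n * ((1 + ∑ j, ‖bargmannSymbol Γ j z‖) ^ n * ‖l2inner (gaussian ε Γ z) ψ‖) := by
        rw [mul_pow, mul_assoc]
    _ ≤ _ := by gcongr; exact h z

end HermanKluk

end

/-! ### Domination of the integrand, and the law of large numbers. -/

noncomputable section

namespace HermanKluk

variable {D : ℕ} {ε : ℝ} {Γ : Matrix (Fin D) (Fin D) ℝ} {V : Config D → ℝ}

/-! ### Integrability of the Herman–Kluk integrand -/

lemma measurable_f₀ (ψ₀ : 𝓢(Config D, ℂ)) : Measurable (f₀ ε Γ ψ₀) := by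
  have hl := measurable_l2inner_gaussian (ε := ε) (Γ := Γ) ψ₀.continuous
  have h1 : Measurable fun w : DoublePhase D => conj (l2inner (gaussian ε Γ w.1) ψ₀) :=
    Complex.continuous_conj.measurable.comp (hl.comp measurable_fst)
  have h2 : Measurable fun w : DoublePhase D => l2inner (gaussian ε Γ w.2) ψ₀ :=
    hl.comp measurable_snd
  simp only [l2inner_conj_symm] at h1
  exact (h1.const_mul _).mul h2

lemma measurable_phaseFactor (hΓ : Γ.PosDef) (hV : IsSubquadratic V) (t : ℝ) :
    Measurable (phaseFactor ε Γ V t) := by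
  have hR := measurable_prefactor hΓ hV t
  have hS := (continuous_action hV t).measurable
  have h1 : Measurable fun w : DoublePhase D => conj (prefactor Γ V t w.1) :=
    Complex.continuous_conj.measurable.comp (hR.comp measurable_fst)
  have h2 : Measurable fun w : DoublePhase D => prefactor Γ V t w.2 := hR.comp measurable_snd
  have h3 : Measurable fun w : DoublePhase D => action V t w.2 - action V t w.1 :=
    (hS.comp measurable_snd).sub (hS.comp measurable_fst)
  have h4 : Measurable fun w : DoublePhase D =>
      Complex.I * ((action V t w.2 - action V t w.1 : ℝ) : ℂ) / (ε : ℂ) :=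
    ((Complex.measurable_ofReal.comp h3).const_mul _).div_const _
  exact (h1.mul h2).mul (Complex.measurable_exp.comp h4)

lemma measurable_overlap (hΓ : Γ.PosDef) (hV : IsSubquadratic V) (A : Observable D) (t : ℝ) :
    Measurable (overlap ε Γ V A t) := by
  have hz := (continuous_trajectory_left hV t).measurable
  have h : Measurable fun w : DoublePhase D => (trajectory V w.1 t, trajectory V w.2 t) :=
    (hz.comp measurable_fst).prodMk (hz.comp measurable_snd)
  have h2 := (measurable_l2inner_apply_gaussian (ε := ε) hΓ hV A).comp h
  exact h2

lemma measurable_integrand (hΓ : Γ.PosDef) (hV : IsSubquadratic V) (ψ₀ : 𝓢(Config D, ℂ))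
    (A : Observable D) (t : ℝ) : Measurable (integrand ε Γ V ψ₀ A t) :=
  ((measurable_f₀ ψ₀).mul (measurable_phaseFactor hΓ hV t)).mul (measurable_overlap hΓ hV A t)

lemma exists_norm_phaseFactor_le (hΓ : Γ.PosDef) (hV : IsSubquadratic V) (t : ℝ) :
    ∃ C : ℝ, 0 ≤ C ∧ ∀ w, ‖phaseFactor ε Γ V t w‖ ≤ C := by
  obtain ⟨C, hC, h⟩ := exists_norm_prefactor_le hΓ hV t
  refine ⟨C * C, by positivity, fun w => ?_⟩
  have e : Complex.I * ((action V t w.2 - action V t w.1 : ℝ) : ℂ) / (ε : ℂ)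
      = (((action V t w.2 - action V t w.1) / ε : ℝ) : ℂ) * Complex.I := by
    push_cast
    ring
  rw [phaseFactor, e, norm_mul, Complex.norm_exp_ofReal_mul_I, mul_one, norm_mul, RCLike.norm_conj]
  exact mul_le_mul (h _) (h _) (norm_nonneg _) hC

lemma exists_norm_overlap_le (hε : 0 < ε) (hΓ : Γ.PosDef) (hV : IsSubquadratic V)
    (A : Observable D) (t : ℝ) : ∃ (C : ℝ) (m : ℕ), 0 ≤ C ∧ ∀ w : DoublePhase D,
      ‖overlap ε Γ V A t w‖ ≤ C * (1 + ‖w.2‖) ^ m := by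
  obtain ⟨C, m, hC, h⟩ := exists_norm_l2inner_apply_gaussian_le hε hΓ hV A
  obtain ⟨K, hK, hk⟩ := exists_one_add_norm_trajectory_le hV t
  refine ⟨C * K ^ m, m, by positivity, fun w => (h _ _).trans ?_⟩
  rw [mul_assoc, ← mul_pow]
  gcongr
  exact hk w.2

lemma integrable_integrand (hε : 0 < ε) (hΓ : Γ.PosDef) (hV : IsSubquadratic V)
    (ψ₀ : 𝓢(Config D, ℂ)) (A : Observable D) (t : ℝ) :
    Integrable (integrand ε Γ V ψ₀ A t) volume := by
  obtain ⟨P, hP, hΦ⟩ := exists_norm_phaseFactor_le (ε := ε) hΓ hV t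
  obtain ⟨O, m, hO, hov⟩ := exists_norm_overlap_le hε hΓ hV A t
  -- One more than the dimension of phase space, so that `(1 + |z|)^{-k}` is integrable. The factor
  -- in `z` is given `m` further powers to absorb the growth of the overlap; the factor in `y` needs
  -- none.
  set k := 2 * D + 1 with hkdef
  obtain ⟨B, hB, hb⟩ := exists_pow_mul_norm_l2inner_gaussian_le hε hΓ k ψ₀
  obtain ⟨C, hC, hc⟩ := exists_pow_mul_norm_l2inner_gaussian_le hε hΓ (m + k) ψ₀
  set c : ℂ := 1 / (2 * (Real.pi : ℂ) * (ε : ℂ)) ^ (2 * D) with hcdef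
  have hint : Integrable fun z : Phase D => ((1 + ‖z‖) ^ k)⁻¹ := by
    have : (volume : Measure (Phase D)).IsAddHaarMeasure := by
      rw [Measure.volume_eq_prod]
      infer_instance
    refine integrable_inv_one_add_norm_pow ?_
    simp [hkdef]
    omega
  refine ((hint.mul_prod hint).const_mul (‖c‖ * B * C * P * O)).mono'
    (measurable_integrand hΓ hV ψ₀ A t).aestronglyMeasurable (ae_of_all _ fun w => ?_)
  have h1 : ‖l2inner ψ₀ (gaussian ε Γ w.1)‖ ≤ B * ((1 + ‖w.1‖) ^ k)⁻¹ := by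
    rw [← l2inner_conj_symm, RCLike.norm_conj, ← div_eq_mul_inv, le_div_iff₀' (by positivity)]
    exact hb w.1
  have h2 : ‖l2inner (gaussian ε Γ w.2) ψ₀‖ * (1 + ‖w.2‖) ^ m ≤ C * ((1 + ‖w.2‖) ^ k)⁻¹ := by
    rw [← div_eq_mul_inv, le_div_iff₀' (by positivity)]
    refine le_trans (le_of_eq ?_) (hc w.2)
    ring
  rw [integrand, f₀, norm_mul, norm_mul, norm_mul, norm_mul]
  calc ‖c‖ * ‖l2inner ψ₀ (gaussian ε Γ w.1)‖ * ‖l2inner (gaussian ε Γ w.2) ψ₀‖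
        * ‖phaseFactor ε Γ V t w‖ * ‖overlap ε Γ V A t w‖
      ≤ ‖c‖ * (B * ((1 + ‖w.1‖) ^ k)⁻¹) * ‖l2inner (gaussian ε Γ w.2) ψ₀‖ * P
        * (O * (1 + ‖w.2‖) ^ m) := by
        gcongr
        · exact hΦ w
        · exact hov w
    _ = ‖c‖ * B * P * O * ((1 + ‖w.1‖) ^ k)⁻¹
        * (‖l2inner (gaussian ε Γ w.2) ψ₀‖ * (1 + ‖w.2‖) ^ m) := by ring
    _ ≤ ‖c‖ * B * P * O * ((1 + ‖w.1‖) ^ k)⁻¹ * (C * ((1 + ‖w.2‖) ^ k)⁻¹) := by gcongr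
    _ = _ := by ring

/-! ### Importance sampling -/

/-- The strong law of large numbers for importance sampling. -/
lemma ae_tendsto_average_div {X : Type*} [MeasurableSpace X] {ν : Measure X} {F : X → ℂ}
    (hFm : Measurable F) (hF : Integrable F ν) {ρ : X → ℝ} (hρm : Measurable ρ)
    (hρ : ∀ᵐ x ∂ν, 0 < ρ x) {Ω : Type*} [MeasurableSpace Ω] {μ : Measure Ω}
    {w : ℕ → Ω → X} (hw : iIndepFun w μ)
    (hlaw : ∀ j, HasLaw (w j) (ν.withDensity fun x => ENNReal.ofReal (ρ x)) μ) :
    ∀ᵐ η ∂μ, Tendsto (fun N : ℕ => (1 / (N : ℂ)) *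
      ∑ j ∈ Finset.range N, F (w j η) / (ρ (w j η) : ℂ)) atTop (𝓝 (∫ x, F x ∂ν)) := by
  set G : X → ℂ := fun x => F x / (ρ x : ℂ) with hG
  have hGm : Measurable G := hFm.div (Complex.measurable_ofReal.comp hρm)
  have hρe : Measurable fun x => ENNReal.ofReal (ρ x) := hρm.ennreal_ofReal
  have hlt : ∀ᵐ x ∂ν, ENNReal.ofReal (ρ x) < ⊤ := ae_of_all _ fun x => ENNReal.ofReal_lt_top
  -- Positivity of `ρ` enters here: where `ρ` vanished, the quotient would be `0` by convention and
  -- that part of `F` would be lost.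
  have hFG : (fun x => (ENNReal.ofReal (ρ x)).toReal • G x) =ᵐ[ν] F := by
    filter_upwards [hρ] with x hx
    have : (ρ x : ℂ) ≠ 0 := by exact_mod_cast hx.ne'
    rw [ENNReal.toReal_ofReal hx.le, Complex.real_smul, hG, mul_div_cancel₀ _ this]
  have hGi : Integrable G (ν.withDensity fun x => ENNReal.ofReal (ρ x)) :=
    (integrable_withDensity_iff_integrable_smul' hρe hlt).2 (hF.congr hFG.symm)
  have hident : ∀ j, IdentDistrib (fun η => G (w j η)) (fun η => G (w 0 η)) μ μ := fun j =>
    IdentDistrib.comp (u := G) ⟨(hlaw j).aemeasurable, (hlaw 0).aemeasurable,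
      (hlaw j).map_eq.trans (hlaw 0).map_eq.symm⟩ hGm
  have hint : Integrable (fun η => G (w 0 η)) μ := by
    rw [← (hlaw 0).map_eq] at hGi
    exact hGi.comp_aemeasurable (hlaw 0).aemeasurable
  have hmean : ∫ η, G (w 0 η) ∂μ = ∫ x, F x ∂ν := by
    rw [← integral_congr_ae hFG, ← integral_withDensity_eq_integral_toReal_smul hρe hlt,
      ← (hlaw 0).map_eq, integral_map (hlaw 0).aemeasurable hGm.aestronglyMeasurable]
  -- This form of the law needs only pairwise independence and a first moment, so no bound on the
  -- variance of `F / ρ` is required.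
  have h := strong_law_ae (fun j η => G (w j η)) hint
    (fun i j hij => (hw.indepFun hij).comp hGm hGm) hident
  filter_upwards [h] with η hη
  rw [← hmean]
  refine hη.congr fun N => ?_
  rw [Complex.real_smul]
  simp [hG]

end HermanKluk

end

theorem lemma3p2 {D : ℕ} (ε : ℝ) (hε : 0 < ε)
    (Γ : Matrix (Fin D) (Fin D) ℝ) (hΓ : Γ.PosDef)
    (V : HermanKluk.Config D → ℝ) (hV : HermanKluk.IsSubquadratic V)
    (A : HermanKluk.Observable D)
    (ψ₀ : 𝓢(HermanKluk.Config D, ℂ)) (hψ₀ : ∫ x, ‖ψ₀ x‖ ^ 2 = 1)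
    (τ : ℝ) (hτ : 0 < τ) (t : ℝ) (ht : t ∈ Set.Icc 0 τ) :
    Integrable (HermanKluk.integrand ε Γ V ψ₀ A t) volume ∧
      ∀ (ρ : HermanKluk.DoublePhase D → ℝ), HermanKluk.IsPosDensity ρ →
        ∀ {Ω : Type*} [MeasurableSpace Ω] (μ : Measure Ω) [IsProbabilityMeasure μ]
          (w : ℕ → Ω → HermanKluk.DoublePhase D),
          iIndepFun w μ →
          (∀ j, HasLaw (w j) (HermanKluk.densityMeasure ρ) μ) →
          ∀ᵐ η ∂μ, Tendsto
            (fun N : ℕ => HermanKluk.crudeEstimator ε Γ V ψ₀ A ρ t (fun j => w j η) N)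
            atTop (𝓝 (HermanKluk.expectation ε Γ V ψ₀ A t)) := by
  have hint := HermanKluk.integrable_integrand hε hΓ hV ψ₀ A t
  refine ⟨hint, fun ρ hρ Ω _ μ _ w hw hlaw => ?_⟩
  filter_upwards [HermanKluk.ae_tendsto_average_div
    (HermanKluk.measurable_integrand hΓ hV ψ₀ A t) hint hρ.measurable hρ.pos hw hlaw] with η hη
  refine hη.congr fun N => ?_
  rw [HermanKluk.crudeEstimator]
  congr 1
  refine Finset.sum_congr rfl fun j _ => ?_
  rw [HermanKluk.integrand]
  ring
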